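/- Let $N\ge 1$ and let $\Omega\subset\mathbb R^N$ be a bounded domain with $C^2$ boundary, $\delta(x)=\mathrm{dist}(x,\partial\Omega)$. Let $s,\gamma\in(0,1]$ with $N>2s$ and $\gamma\ge s-\tfrac12$. Let $\mathbb L$ be a linear operator admitting a (Borel measurable) Green function $G:\{(x,y)\in\Omega\times\Omega: x\ne y\}\to(0,\infty)$, that is: for every $f\in C_c^\infty(\Omega)$ the function $\mathbb G[f](x)=\int_\Omega G(x,y)f(y)\,dy$ is the unique classical solution of $\mathbb Lu=f$ in $\Omega$ with $u=0$ on $\partial\Omega$ (and in $\mathbb R^N\setminus\Omega$ if applicable); $G$ is symmetric; and for some constants $c,C>0$ and all $x\neq y$ in $\Omega$, $$c\,K(x,y)\le G(x,y)\le C\,K(x,y),\qquad K(x,y)=\frac{1}{|x-y|^{N-2s}}\Big(\frac{\delta(x)}{|x-y|}\wedge1\Big)^{\gamma}\Big(\frac{\delta(y)}{|x-y|}\wedge1\Big)^{\gamma}.$$ For a positive Radon measure $\mu$ on $\Omega$ put $\|\mu\|=\int_\Omega\delta^\gamma\,d\mu$, let $\mathcal M^+(\Omega,\delta^\gamma)$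 be the set of those with $\|\mu\|<\infty$, and put $\mathbb G[\mu](x)=\int_\Omega G(x,y)\,d\mu(y)$. For $p>1$, $\lambda>0$ and $\mu\in\mathcal M^+(\Omega,\delta^\gamma)$, a nonnegative weak-dual solution of $$\mathbb Lu=u^p+\lambda\mu\quad\text{in }\Omega\text{ with homogeneous Dirichlet condition}\tag{$P_\lambda$}$$ is a function $u\ge0$ (a.e. in $\Omega$) with $\int_\Omega u^p\delta^\gamma\,dx<\infty$ and $$\int_\Omega u\,\xi\,dx=\int_\Omega u^p\,\mathbb G[\xi]\,dx+\lambda\int_\Omega\mathbb G[\xi]\,d\mu\qquad\text{for all }\xi=\delta^\gamma v,\ v\in L^\infty(\Omega).$$ A minimal positive weak-dual solution is one that is positive a.e. and is a.e. bounded above by every nonnegative weak-dual solution. Let $p>1$ and $p^*=\frac{N+\gamma}{N+\gamma-2s}$. 1. Let $p<p^*$ and $\mu\in\mathcal M^+(\Omega,\delta^\gamma)$ with $\|\mu\|=1$. Then there are $\lambda^*\in(0,\infty)$ and an increasing function $T$ on $(0,\lambda^*]$ with $T(\lambda)\to0$ as $\lambda\to0^+$ such that: (i) for every $\lambda\in(0,\lambda^*]$,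 $(P_\lambda)$ has a minimal positive weak-dual solution $\underline u_\lambda$, and $\lambda\,\mathbb G[\mu]\le\underline u_\lambda\le T(\lambda)\,\mathbb G[\mu]$ a.e. in $\Omega$; (ii) for every $\lambda>\lambda^*$, $(P_\lambda)$ has no nonnegative weak-dual solution. 2. Let $p\ge p^*$. For every $\lambda>0$ there is $\mu\in\mathcal M^+(\Omega,\delta^\gamma)$ with $\|\mu\|=1$ such that $(P_\lambda)$ has no nonnegative weak-dual solution. -/

import Mathlib

open MeasureTheory Filter Topology

namespace NonlocalGreen

/-- The Euclidean space `ℝ^N`. -/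
abbrev Eucl (N : ℕ) : Type := EuclideanSpace ℝ (Fin N)

/-- A bounded domain (nonempty connected open set) with `C²` boundary: near each boundary point
the set is `{ρ < 0}` for a `C²` function `ρ` whose differential does not vanish at that point. -/
structure IsBoundedC2Domain {N : ℕ} (Ω : Set (Eucl N)) : Prop where
  isOpen : IsOpen Ω
  isConnected : IsConnected Ω
  isBounded : Bornology.IsBounded Ω
  boundary : ∀ z ∈ frontier Ω, ∃ U : Set (Eucl N), IsOpen U ∧ z ∈ U ∧
    ∃ ρ : Eucl N → ℝ, ContDiffOn ℝ 2 ρ U ∧ fderiv ℝ ρ z ≠ 0 ∧ Ω ∩ U = {x ∈ U | ρ x < 0}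

/-- The distance `δ(x)` to the boundary of `Ω`. -/
noncomputable def bdist {N : ℕ} (Ω : Set (Eucl N)) (x : Eucl N) : ℝ :=
  Metric.infDist x (frontier Ω)

/-- Membership in `C_c^∞(Ω)`. -/
def IsTestFunction {N : ℕ} (Ω : Set (Eucl N)) (f : Eucl N → ℝ) : Prop :=
  ContDiff ℝ ((⊤ : ℕ∞) : WithTop ℕ∞) f ∧ HasCompactSupport f ∧ tsupport f ⊆ Ω

/-- The Green operator on functions, `𝔾[f](x) = ∫_Ω G(x,y) f(y) dy`. -/
noncomputable def greenFun {N : ℕ} (Ω : Set (Eucl N)) (G : Eucl N → Eucl N → ℝ)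
    (f : Eucl N → ℝ) (x : Eucl N) : ℝ :=
  ∫ y in Ω, G x y * f y

/-- The Green operator on measures, `𝔾[μ](x) = ∫_Ω G(x,y) dμ(y)`. The kernel is given only off
the diagonal, so the point `y = x` is left out; this matters only at the atoms of `μ`, a countable
set of points `x`. -/
noncomputable def greenMeas {N : ℕ} (Ω : Set (Eucl N)) (G : Eucl N → Eucl N → ℝ)
    (μ : Measure (Eucl N)) (x : Eucl N) : ℝ :=
  ∫ y in Ω \ {x}, G x y ∂μ

/-- `|x-y|^{-(N-2s)} (δ(x)/|x-y| ∧ 1)^γ (δ(y)/|x-y| ∧ 1)^γ`. -/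
noncomputable def modelKernel {N : ℕ} (Ω : Set (Eucl N)) (s γ : ℝ) (x y : Eucl N) : ℝ :=
  1 / ‖x - y‖ ^ ((N : ℝ) - 2 * s) * (min (bdist Ω x / ‖x - y‖) 1) ^ γ
    * (min (bdist Ω y / ‖x - y‖) 1) ^ γ

/-- `u` is a classical solution of `L u = f` in `Ω` with homogeneous Dirichlet condition.
`L.domain` is the class of functions to which the linear operator `L` applies classically.
Functions on `Ω` are identified with their extension by `0` to `ℝ^N`. -/
def IsClassicalSolution {N : ℕ} (Ω : Set (Eucl N)) (L : (Eucl N → ℝ) →ₗ.[ℝ] (Ω → ℝ))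
    (f u : Eucl N → ℝ) : Prop :=
  (∃ hu : u ∈ L.domain, ∀ x : Ω, L ⟨u, hu⟩ x = f x) ∧
    (∀ x ∉ Ω, u x = 0) ∧ ∀ z ∈ frontier Ω, Tendsto u (𝓝[Ω] z) (𝓝 0)

/-- `G` is a Green function of the operator `L` on `Ω`, with the two-sided estimates of
exponents `s` and `γ`. Values of `G` on the diagonal or outside `Ω × Ω` are never used. -/
structure IsGreenFunction {N : ℕ} (Ω : Set (Eucl N)) (s γ : ℝ)
    (L : (Eucl N → ℝ) →ₗ.[ℝ] (Ω → ℝ)) (G : Eucl N → Eucl N → ℝ) : Prop where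
  /-- For `f ∈ C_c^∞(Ω)` the function `𝔾[f]` is the unique classical solution. -/
  solves : ∀ f, IsTestFunction Ω f → ∀ u : Eucl N → ℝ,
    IsClassicalSolution Ω L f u ↔ u = Ω.indicator (greenFun Ω G f)
  measurable : Measurable
    (Set.domRestrict {z : Eucl N × Eucl N | z.1 ∈ Ω ∧ z.2 ∈ Ω ∧ z.1 ≠ z.2} (fun z => G z.1 z.2))
  pos : ∀ x ∈ Ω, ∀ y ∈ Ω, x ≠ y → 0 < G x y
  symm : ∀ x ∈ Ω, ∀ y ∈ Ω, x ≠ y → G x y = G y x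
  two_sided : ∃ c C : ℝ, 0 < c ∧ 0 < C ∧ ∀ x ∈ Ω, ∀ y ∈ Ω, x ≠ y →
    c * modelKernel Ω s γ x y ≤ G x y ∧ G x y ≤ C * modelKernel Ω s γ x y

/-- The norm `∫_Ω δ^γ dμ` of a positive measure. -/
noncomputable def weightedNorm {N : ℕ} (Ω : Set (Eucl N)) (γ : ℝ) (μ : Measure (Eucl N)) :
    ENNReal :=
  ∫⁻ x in Ω, ENNReal.ofReal (bdist Ω x ^ γ) ∂μ

/-- The cone `𝓜⁺(Ω, δ^γ)` of positive Radon measures on `Ω` (Borel measures carried by `Ω` and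
finite on compact subsets of `Ω`; regularity is automatic) with `∫_Ω δ^γ dμ < ∞`. -/
structure IsWeightedRadon {N : ℕ} (Ω : Set (Eucl N)) (γ : ℝ) (μ : Measure (Eucl N)) : Prop where
  carried : μ Ωᶜ = 0
  finite_compact : ∀ K : Set (Eucl N), K ⊆ Ω → IsCompact K → μ K < ⊤
  finite_norm : weightedNorm Ω γ μ < ⊤

/-- The measure `δ^γ dx` on `Ω`. -/
noncomputable def weightedVolume {N : ℕ} (Ω : Set (Eucl N)) (γ : ℝ) : Measure (Eucl N) :=
  (volume.restrict Ω).withDensity (fun x => ENNReal.ofReal (bdist Ω x ^ γ))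

/-- The space `δ^γ L^∞(Ω)`. -/
def weightedLinfty {N : ℕ} (Ω : Set (Eucl N)) (γ : ℝ) : Set (Eucl N → ℝ) :=
  {ξ | ∃ v : Eucl N → ℝ, MemLp v ⊤ (volume.restrict Ω) ∧ ∀ x ∈ Ω, ξ x = bdist Ω x ^ γ * v x}

/-- Nonnegative weak-dual solutions of `L u = u^p + lam μ` with homogeneous Dirichlet condition,
`G` being the Green function of `L`. For such functions membership in `L^p(Ω, δ^γ)` includes
local `p`-integrability, as `δ^γ` is bounded below on compact subsets of `Ω`. -/
structure IsNonnegWeakDualSolution {N : ℕ} (Ω : Set (Eucl N)) (γ : ℝ) (G : Eucl N → Eucl N → ℝ)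
    (p lam : ℝ) (μ : Measure (Eucl N)) (u : Eucl N → ℝ) : Prop where
  nonneg : ∀ᵐ x ∂(volume.restrict Ω), 0 ≤ u x
  memLp : MemLp u (ENNReal.ofReal p) (weightedVolume Ω γ)
  weak_dual : ∀ ξ ∈ weightedLinfty Ω γ,
    ∫ x in Ω, u x * ξ x
      = (∫ x in Ω, u x ^ p * greenFun Ω G ξ x) + lam * ∫ x in Ω, greenFun Ω G ξ x ∂μ

/-- `u` is the minimal positive weak-dual solution: it is positive and it lies below every
nonnegative weak-dual solution. -/
structure IsMinimalPositiveSolution {N : ℕ} (Ω : Set (Eucl N)) (γ : ℝ)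
    (G : Eucl N → Eucl N → ℝ) (p lam : ℝ) (μ : Measure (Eucl N)) (u : Eucl N → ℝ) : Prop where
  solution : IsNonnegWeakDualSolution Ω γ G p lam μ u
  pos : ∀ᵐ x ∂(volume.restrict Ω), 0 < u x
  minimal : ∀ v : Eucl N → ℝ, IsNonnegWeakDualSolution Ω γ G p lam μ v →
    ∀ᵐ x ∂(volume.restrict Ω), u x ≤ v x

/-- The critical exponent `p* = (N+γ)/(N+γ-2s)`. -/
noncomputable def criticalExponent (N : ℕ) (s γ : ℝ) : ℝ :=
  ((N : ℝ) + γ) / ((N : ℝ) + γ - 2 * s)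

end NonlocalGreen

/-!
A weak-dual solution is the same thing as a function `u ≥ 0` with `∫ u^p δ^γ < ∞` that solves the
integral equation `u = 𝔾[u^p] + λ 𝔾[μ]` almost everywhere: by Fubini's theorem both sides of the
weak-dual identity are integrals against `ξ`, and `ξ` is arbitrary in `δ^γ L^∞`
(`isNonnegWeakDualSolution_iff`). The rest is potential theory for this equation in `[0, ∞]`, where
everything is monotone.

Write `w = δ^γ` and `G(x,y) ≍ w(x) w(y) H(x,y)`. The point is that `1 / H` is comparable to
`|x-y|^{N-2s} max(|x-y|, δ(x), δ(y))^{2γ}`, which is a quasi-metric since `δ` is `1`-Lipschitz. Hence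
`H(x,y) H(y,z) ≤ k H(x,z) (H(x,y) + H(y,z))` (`reducedKernel_mul_le`). Moreover
`H(x,y)^p w(y)^{p+1} ≤ |x-y|^{-(N-2s+γ)p+γ}`, whose integral over `Ω` is bounded in `x` when
`p < p*`. With Jensen's inequality for `w dμ` this gives
`𝔾[𝔾[μ]^p] ≤ K ‖μ‖^{p-1} 𝔾[μ]` (`IsWeightedKernel.potential_potential_rpow_le`).

For `p < p*` this estimate makes `2λ 𝔾[μ]` a supersolution for small `λ`, so that monotone
iteration converges to the least solution. Since `H` is bounded below, every solution satisfies
`u ≥ c w (∫ u^p w + λ)`, which bounds `λ + ∫ u^p w` by a constant depending neither on `λ` nor on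
the normalized datum (`IsWeightedKernel.add_le_aprioriBound`). So the admissible `λ` are bounded,
and their supremum `λ*` is admissible by monotone convergence. The solution at `λ*` is at most
`A 𝔾[μ]`: the part of `u^p` where `u > n w` has small norm for large `n`, and its potential is
absorbed by the estimate above (`IsWeightedKernel.exists_le_potential`). Finally `θ u` is a
supersolution for `θ λ*` when `θ ≤ 1`, so that `T(λ)` may be taken proportional to `λ`.

For `p ≥ p*` a solution for a normalized point mass `μ = w(z)⁻¹ δ_z` would give
`λ^p ∫ 𝔾[μ]^p w ≤ ∫ u^p w`, which is at most the a priori constant, whereas the left-hand side is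
unbounded as `z` approaches a boundary point that is nearest to some point of `Ω`
(`exists_lt_lintegral_greenKernel_rpow`).
-/

namespace NonlocalGreen

open scoped ENNReal

/-! ### Weighted kernels and their potentials -/

section Abstract
variable {E : Type*} [MeasurableSpace E]

/-- The potential `x ↦ ∫ g(x,y) dμ(y)` of a measure `μ` for a kernel `g`, as an extended number. -/
noncomputable def potential (g : E → E → ℝ≥0∞) (μ : Measure E) (x : E) : ℝ≥0∞ :=
  ∫⁻ y, g x y ∂μ

/-- A symmetric kernel `g` with a weight `w`, relative to a finite nonzero measure `ν` carried by
`S`. On `S` the weight is positive and bounded, the kernel is at least `c w(x) w(y)`, and its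
integral operator maps the weight to a multiple of the weight. The model is the Green function of
a domain `S` with `w = δ^γ`. The kernel may be infinite, as on the diagonal. A single constant `C`
bounds both the weight and the integral operator. -/
structure IsWeightedKernel (ν : Measure E) (S : Set E) (g : E → E → ℝ≥0∞) (w : E → ℝ≥0∞)
    (c C : ℝ≥0∞) : Prop where
  measurable_kernel : Measurable (Function.uncurry g)
  measurable_weight : Measurable w
  symm : ∀ x y, g x y = g y x
  ae_mem : ∀ᵐ x ∂ν, x ∈ S
  measure_ne_zero : ν ≠ 0
  measure_ne_top : ν Set.univ ≠ ⊤
  lower_ne_zero : c ≠ 0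
  lower_ne_top : c ≠ ⊤
  upper_ne_top : C ≠ ⊤
  weight_ne_zero : ∀ x ∈ S, w x ≠ 0
  weight_le : ∀ x ∈ S, w x ≤ C
  le_kernel : ∀ x ∈ S, ∀ y ∈ S, c * (w x * w y) ≤ g x y
  lintegral_le : ∀ x ∈ S, ∫⁻ y, g x y * w y ∂ν ≤ C * w x

/-- The two integral bounds for a weighted kernel that hold for subcritical exponents `p`: a
three-point estimate, and a uniform weighted `L^p` bound for the normalized kernel
`g(·,z) / w(z)`. -/
structure IsSubcritical (ν : Measure E) (S : Set E) (g : E → E → ℝ≥0∞) (w : E → ℝ≥0∞)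
    (p : ℝ) (K : ℝ≥0∞) : Prop where
  ne_top : K ≠ ⊤
  three_point : ∀ x ∈ S, ∀ z ∈ S,
    ∫⁻ y, g x y * (g y z / w z) ^ p ∂ν ≤ K * (g x z / w z)
  lintegral_le : ∀ z ∈ S, ∫⁻ y, (g y z / w z) ^ p * w y ∂ν ≤ K

theorem lintegral_rpow_le {m : Measure E} {f : E → ℝ≥0∞} (hf : AEMeasurable f m) {p : ℝ}
    (hp : 1 < p) : (∫⁻ x, f x ∂m) ^ p ≤ m Set.univ ^ (p - 1) * ∫⁻ x, f x ^ p ∂m := by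
  have h := ENNReal.lintegral_mul_le_Lp_mul_Lq m (Real.HolderConjugate.conjExponent hp) hf
    (aemeasurable_const (b := (1 : ℝ≥0∞)))
  have hp0 : (0 : ℝ) < p := by linarith
  have hp1 : p - 1 ≠ 0 := by linarith
  have h2 := ENNReal.rpow_le_rpow h hp0.le
  simp only [Pi.mul_apply, mul_one, ENNReal.one_rpow, lintegral_const, one_mul] at h2
  rw [ENNReal.mul_rpow_of_nonneg _ _ hp0.le, ← ENNReal.rpow_mul, ← ENNReal.rpow_mul] at h2
  have e1 : 1 / p * p = 1 := by field_simp
  have e2 : 1 / p.conjExponent * p = p - 1 := by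
    unfold Real.conjExponent; field_simp
  rw [e1, e2, ENNReal.rpow_one, mul_comm] at h2
  exact h2

variable {ν : Measure E} {S : Set E} {g : E → E → ℝ≥0∞} {w : E → ℝ≥0∞} {c C : ℝ≥0∞}

namespace IsWeightedKernel

theorem weight_ne_top (h : IsWeightedKernel ν S g w c C) {x : E} (hx : x ∈ S) : w x ≠ ⊤ :=
  ne_top_of_le_ne_top h.upper_ne_top (h.weight_le x hx)

theorem measurable_section (h : IsWeightedKernel ν S g w c C) (x : E) : Measurable (g x) :=
  h.measurable_kernel.comp measurable_prodMk_left

theorem measurable_section' (h : IsWeightedKernel ν S g w c C) (z : E) :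
    Measurable fun y => g y z :=
  h.measurable_kernel.comp measurable_prodMk_right

theorem measurable_potential (h : IsWeightedKernel ν S g w c C) (μ : Measure E) [SFinite μ] :
    Measurable (potential g μ) :=
  Measurable.lintegral_prod_right' h.measurable_kernel

theorem potential_withDensity (h : IsWeightedKernel ν S g w c C) {f : E → ℝ≥0∞}
    (hf : AEMeasurable f ν) (x : E) :
    potential g (ν.withDensity f) x = ∫⁻ y, g x y * f y ∂ν := by
  unfold potential
  rw [lintegral_withDensity_eq_lintegral_mul₀ hf (h.measurable_section x).aemeasurable]
  simp [mul_comm]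

/-- Jensen's inequality for the measure `w dμ`. -/
theorem potential_rpow_le (h : IsWeightedKernel ν S g w c C) {μ : Measure E}
    (hμ : ∀ᵐ x ∂μ, x ∈ S) {p : ℝ} (hp : 1 < p) (y : E) :
    potential g μ y ^ p
      ≤ (∫⁻ z, w z ∂μ) ^ (p - 1) * ∫⁻ z, (g y z / w z) ^ p * w z ∂μ := by
  have hm : Measurable fun z => g y z / w z := (h.measurable_section y).div h.measurable_weight
  have e : potential g μ y = ∫⁻ z, g y z / w z ∂(μ.withDensity w) := by
    rw [lintegral_withDensity_eq_lintegral_mul _ h.measurable_weight hm]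
    refine lintegral_congr_ae ?_
    filter_upwards [hμ] with z hz
    exact (ENNReal.mul_div_cancel (h.weight_ne_zero z hz) (h.weight_ne_top hz)).symm
  have := lintegral_rpow_le (m := μ.withDensity w) hm.aemeasurable hp
  rw [← e, withDensity_apply _ MeasurableSet.univ, Measure.restrict_univ,
    lintegral_withDensity_eq_lintegral_mul _ h.measurable_weight (hm.pow_const p)] at this
  simpa [mul_comm] using this

theorem lintegral_potential_mul (h : IsWeightedKernel ν S g w c C) {μ : Measure E} [SFinite μ]
    [SFinite ν] {f : E → ℝ≥0∞} (hf : Measurable f) :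
    ∫⁻ x, potential g μ x * f x ∂ν = ∫⁻ y, (∫⁻ x, g y x * f x ∂ν) ∂μ := by
  unfold potential
  have hm : Measurable fun q : E × E => g q.1 q.2 := h.measurable_kernel
  rw [lintegral_lintegral_swap (hm.mul (hf.comp measurable_snd)).aemeasurable]
  refine lintegral_congr fun x => ?_
  rw [← lintegral_mul_const _ (h.measurable_section x)]
  exact lintegral_congr fun y => by rw [h.symm]

theorem lintegral_potential_mul_weight_le (h : IsWeightedKernel ν S g w c C) {μ : Measure E}
    [SFinite μ] [SFinite ν] (hμ : ∀ᵐ x ∂μ, x ∈ S) :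
    ∫⁻ x, potential g μ x * w x ∂ν ≤ C * ∫⁻ x, w x ∂μ := by
  rw [h.lintegral_potential_mul h.measurable_weight, ← lintegral_const_mul _ h.measurable_weight]
  refine lintegral_mono_ae ?_
  filter_upwards [hμ] with x hx using h.lintegral_le x hx

/-- The lower bound of the kernel gives a lower bound of potentials by the weight. -/
theorem le_potential (h : IsWeightedKernel ν S g w c C) {μ : Measure E} (hμ : ∀ᵐ x ∂μ, x ∈ S)
    {x : E} (hx : x ∈ S) : c * (w x * ∫⁻ y, w y ∂μ) ≤ potential g μ x := by
  unfold potential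
  rw [← mul_assoc, ← lintegral_const_mul _ h.measurable_weight]
  refine lintegral_mono_ae ?_
  filter_upwards [hμ] with y hy
  rw [mul_assoc]
  exact h.le_kernel x hx y hy

/-- The estimate behind the subcritical range: the potential of the `p`-th power of a potential
is controlled by the potential itself. -/
theorem potential_potential_rpow_le (h : IsWeightedKernel ν S g w c C) {p : ℝ} (hp : 1 < p)
    {K : ℝ≥0∞} (hK : IsSubcritical ν S g w p K) {μ : Measure E} [SFinite μ] [SFinite ν]
    (hμ : ∀ᵐ x ∂μ, x ∈ S) {x : E} (hx : x ∈ S) :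
    ∫⁻ y, g x y * potential g μ y ^ p ∂ν
      ≤ K * (∫⁻ z, w z ∂μ) ^ (p - 1) * potential g μ x := by
  have hm : Measurable fun q : E × E => g q.1 q.2 := h.measurable_kernel
  have hF : Measurable fun q : E × E => (g q.1 q.2 / w q.2) ^ p * w q.2 :=
    ((hm.div (h.measurable_weight.comp measurable_snd)).pow_const p).mul
      (h.measurable_weight.comp measurable_snd)
  have hI : Measurable fun y => ∫⁻ z, (g y z / w z) ^ p * w z ∂μ :=
    Measurable.lintegral_prod_right' hF
  set M := ∫⁻ z, w z ∂μ
  calc ∫⁻ y, g x y * potential g μ y ^ p ∂ν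
      ≤ ∫⁻ y, M ^ (p - 1) * (g x y * ∫⁻ z, (g y z / w z) ^ p * w z ∂μ) ∂ν := by
        refine lintegral_mono fun y => ?_
        rw [mul_left_comm]
        gcongr
        exact h.potential_rpow_le hμ hp y
    _ = M ^ (p - 1) * ∫⁻ y, ∫⁻ z, g x y * ((g y z / w z) ^ p * w z) ∂μ ∂ν := by
        rw [lintegral_const_mul _ (show Measurable fun y => g x y * _ from
          (h.measurable_section x).mul hI)]
        congr 1
        refine lintegral_congr fun y => ?_
        exact (lintegral_const_mul _ (hF.comp measurable_prodMk_left)).symm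
    _ = M ^ (p - 1) * ∫⁻ z, ∫⁻ y, g x y * ((g y z / w z) ^ p * w z) ∂ν ∂μ := by
        rw [lintegral_lintegral_swap
          (((h.measurable_section x).comp measurable_fst).mul hF).aemeasurable]
    _ ≤ M ^ (p - 1) * ∫⁻ z, K * g x z ∂μ := by
        gcongr M ^ (p - 1) * ?_
        refine lintegral_mono_ae ?_
        filter_upwards [hμ] with z hz
        calc ∫⁻ y, g x y * ((g y z / w z) ^ p * w z) ∂ν
            = (∫⁻ y, g x y * (g y z / w z) ^ p ∂ν) * w z := by
              refine Eq.trans (lintegral_congr fun y => ?_) (lintegral_mul_const _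
                ((h.measurable_section x).mul
                  (((h.measurable_section' z).div_const (w z)).pow_const p)))
              ring
          _ ≤ K * (g x z / w z) * w z := by gcongr; exact hK.three_point x hx z hz
          _ = K * g x z := by
              rw [mul_assoc, ENNReal.div_mul_cancel (h.weight_ne_zero z hz) (h.weight_ne_top hz)]
    _ = _ := by
        rw [lintegral_const_mul _ (h.measurable_section x)]
        unfold potential; ring

/-- In the subcritical range potentials lie in `L^p` for the measure `w dν`. -/
theorem lintegral_potential_rpow_le (h : IsWeightedKernel ν S g w c C) {p : ℝ} (hp : 1 < p)
    {K : ℝ≥0∞} (hK : IsSubcritical ν S g w p K) {μ : Measure E} [SFinite μ] [SFinite ν]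
    (hμ : ∀ᵐ x ∂μ, x ∈ S) :
    ∫⁻ y, potential g μ y ^ p * w y ∂ν
      ≤ (∫⁻ z, w z ∂μ) ^ (p - 1) * (K * ∫⁻ z, w z ∂μ) := by
  have hm : Measurable fun q : E × E => g q.1 q.2 := h.measurable_kernel
  have hF : Measurable fun q : E × E => (g q.1 q.2 / w q.2) ^ p * w q.2 :=
    ((hm.div (h.measurable_weight.comp measurable_snd)).pow_const p).mul
      (h.measurable_weight.comp measurable_snd)
  have hI : Measurable fun y => ∫⁻ z, (g y z / w z) ^ p * w z ∂μ :=
    Measurable.lintegral_prod_right' hF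
  set M := ∫⁻ z, w z ∂μ with hM
  calc ∫⁻ y, potential g μ y ^ p * w y ∂ν
      ≤ ∫⁻ y, M ^ (p - 1) * ((∫⁻ z, (g y z / w z) ^ p * w z ∂μ) * w y) ∂ν := by
        refine lintegral_mono fun y => ?_
        rw [← mul_assoc]
        gcongr
        exact h.potential_rpow_le hμ hp y
    _ = M ^ (p - 1) * ∫⁻ y, ∫⁻ z, (g y z / w z) ^ p * w z * w y ∂μ ∂ν := by
        rw [lintegral_const_mul _ (show Measurable fun y => _ * w y from
          hI.mul h.measurable_weight)]
        congr 1
        refine lintegral_congr fun y => ?_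
        exact (lintegral_mul_const _ (hF.comp measurable_prodMk_left)).symm
    _ = M ^ (p - 1) * ∫⁻ z, ∫⁻ y, (g y z / w z) ^ p * w z * w y ∂ν ∂μ := by
        rw [lintegral_lintegral_swap
          (hF.mul (h.measurable_weight.comp measurable_fst)).aemeasurable]
    _ ≤ M ^ (p - 1) * ∫⁻ z, K * w z ∂μ := by
        gcongr M ^ (p - 1) * ?_
        refine lintegral_mono_ae ?_
        filter_upwards [hμ] with z hz
        calc ∫⁻ y, (g y z / w z) ^ p * w z * w y ∂ν
            = (∫⁻ y, (g y z / w z) ^ p * w y ∂ν) * w z := by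
              refine Eq.trans (lintegral_congr fun y => ?_) (lintegral_mul_const _
                ((((h.measurable_section' z).div_const (w z)).pow_const p).mul
                  h.measurable_weight))
              ring
          _ ≤ K * w z := by gcongr; exact hK.lintegral_le z hz
    _ = _ := by rw [lintegral_const_mul _ h.measurable_weight]

end IsWeightedKernel
end Abstract

/-! ### The least solution and the a priori bound -/

section Abstract
variable {E : Type*} [MeasurableSpace E]

/-- The monotone iteration `u₀ = 0`, `uₖ₊₁ = ∫ g(·,y) uₖ(y)^p dν(y) + F`. -/
noncomputable def picard (g : E → E → ℝ≥0∞) (ν : Measure E) (p : ℝ) (F : E → ℝ≥0∞) :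
    ℕ → E → ℝ≥0∞
  | 0 => 0
  | k + 1 => fun x => ∫⁻ y, g x y * picard g ν p F k y ^ p ∂ν + F x

/-- The limit of the monotone iteration; it may take the value `⊤`. -/
noncomputable def leastSolution (g : E → E → ℝ≥0∞) (ν : Measure E) (p : ℝ) (F : E → ℝ≥0∞)
    (x : E) : ℝ≥0∞ :=
  ⨆ k, picard g ν p F k x

theorem iSup_rpow {ι : Sort*} (f : ι → ℝ≥0∞) {p : ℝ} (hp : 0 < p) :
    (⨆ i, f i) ^ p = ⨆ i, f i ^ p :=
  (ENNReal.orderIsoRpow p hp).map_iSup f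

variable {ν : Measure E} {S : Set E} {g : E → E → ℝ≥0∞} {w : E → ℝ≥0∞} {c C : ℝ≥0∞}
  {p : ℝ} {F F' : E → ℝ≥0∞}

theorem picard_mono_source (hp : 0 ≤ p) (hF : ∀ x, F x ≤ F' x) (k : ℕ) (x : E) :
    picard g ν p F k x ≤ picard g ν p F' k x := by
  induction k generalizing x with
  | zero => exact le_rfl
  | succ k ih =>
    simp only [picard]
    gcongr with y
    · exact ih y
    · exact hF x

theorem leastSolution_mono_source (hp : 0 ≤ p) (hF : ∀ x, F x ≤ F' x) (x : E) :
    leastSolution g ν p F x ≤ leastSolution g ν p F' x :=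
  iSup_mono fun k => picard_mono_source hp hF k x

theorem picard_le_succ (hp : 0 ≤ p) (k : ℕ) (x : E) :
    picard g ν p F k x ≤ picard g ν p F (k + 1) x := by
  induction k generalizing x with
  | zero => exact zero_le
  | succ k ih =>
    change ∫⁻ y, g x y * picard g ν p F k y ^ p ∂ν + F x
      ≤ ∫⁻ y, g x y * picard g ν p F (k + 1) y ^ p ∂ν + F x
    gcongr with y
    exact ih y

/-- The limit of the monotone iteration lies below every supersolution. -/
theorem leastSolution_le (hp : 0 ≤ p) {v : E → ℝ≥0∞}
    (hv : ∀ᵐ x ∂ν, ∫⁻ y, g x y * v y ^ p ∂ν + F x ≤ v x) :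
    ∀ᵐ x ∂ν, leastSolution g ν p F x ≤ v x := by
  have : ∀ k, ∀ᵐ x ∂ν, picard g ν p F k x ≤ v x := by
    intro k
    induction k with
    | zero => exact Eventually.of_forall fun x => zero_le
    | succ k ih =>
      filter_upwards [hv] with x hx
      refine le_trans ?_ hx
      rw [picard]
      gcongr ?_ + _
      refine lintegral_mono_ae ?_
      filter_upwards [ih] with y hy
      gcongr
  filter_upwards [ae_all_iff.2 this] with x hx using iSup_le hx

/-- The bound for `λ + ∫ u^p w` that holds for all solutions `u` with data of norm one; it
involves only the weight and the constant in the lower bound of the kernel. -/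
noncomputable def aprioriBound (ν : Measure E) (w : E → ℝ≥0∞) (c : ℝ≥0∞) (p : ℝ) : ℝ≥0∞ :=
  ((c ^ p * ∫⁻ x, w x ^ p * w x ∂ν)⁻¹) ^ (1 / (p - 1))

namespace IsWeightedKernel

theorem measurable_picard [SFinite ν] (h : IsWeightedKernel ν S g w c C) (hF : Measurable F)
    (k : ℕ) : Measurable (picard g ν p F k) := by
  induction k with
  | zero => exact measurable_const
  | succ k ih =>
    exact (Measurable.lintegral_prod_right' (f := fun q : E × E => g q.1 q.2 *
      picard g ν p F k q.2 ^ p) (h.measurable_kernel.mul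
        ((ih.comp measurable_snd).pow_const p))).add hF

theorem measurable_leastSolution [SFinite ν] (h : IsWeightedKernel ν S g w c C)
    (hF : Measurable F) : Measurable (leastSolution g ν p F) :=
  Measurable.iSup fun k => h.measurable_picard hF k

/-- The limit of the monotone iteration solves the integral equation at every point. -/
theorem leastSolution_eq [SFinite ν] (h : IsWeightedKernel ν S g w c C) (hF : Measurable F)
    (hp : 0 < p) (x : E) :
    leastSolution g ν p F x = ∫⁻ y, g x y * leastSolution g ν p F y ^ p ∂ν + F x := by
  have hmono : ∀ y, Monotone fun k => picard g ν p F k y :=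
    fun y => monotone_nat_of_le_succ fun k => picard_le_succ hp.le k y
  have e : ∫⁻ y, g x y * leastSolution g ν p F y ^ p ∂ν
      = ⨆ k, ∫⁻ y, g x y * picard g ν p F k y ^ p ∂ν := by
    rw [← lintegral_iSup]
    · refine lintegral_congr fun y => ?_
      rw [leastSolution, iSup_rpow _ hp, ENNReal.mul_iSup]
    · exact fun k => (h.measurable_section x).mul ((h.measurable_picard hF k).pow_const p)
    · intro i j hij y
      have := hmono y hij
      dsimp only at this ⊢
      gcongr
  rw [e, ENNReal.iSup_add, leastSolution, ← (hmono x).iSup_nat_add 1]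
  rfl

theorem ae_lt_top_of_lintegral_ne_top (h : IsWeightedKernel ν S g w c C) {u : E → ℝ≥0∞}
    (hu : AEMeasurable u ν) (hp : 0 < p) (hX : ∫⁻ x, u x ^ p * w x ∂ν ≠ ⊤) :
    ∀ᵐ x ∂ν, u x < ⊤ := by
  filter_upwards [ae_lt_top' ((hu.pow_const p).mul h.measurable_weight.aemeasurable) hX,
    h.ae_mem] with x hx hS
  rw [lt_top_iff_ne_top] at hx ⊢
  rintro hxt
  simp [hxt, ENNReal.top_rpow_of_pos hp, h.weight_ne_zero x hS] at hx

theorem aprioriBound_ne_top (h : IsWeightedKernel ν S g w c C) (hp : 1 < p) :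
    aprioriBound ν w c p ≠ ⊤ := by
  have hm : Measurable fun x => w x ^ p * w x :=
    (h.measurable_weight.pow_const p).mul h.measurable_weight
  refine ENNReal.rpow_ne_top_of_nonneg (by apply one_div_nonneg.2; linarith) ?_
  rw [ENNReal.inv_ne_top]
  refine mul_ne_zero (by simp [ENNReal.rpow_eq_zero_iff, h.lower_ne_zero, h.lower_ne_top]) ?_
  intro h0
  rw [lintegral_eq_zero_iff hm] at h0
  apply h.measure_ne_zero
  rw [← ae_eq_bot, ← empty_mem_iff_bot]
  filter_upwards [h0, h.ae_mem] with x hx hS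
  have h1 := h.weight_ne_zero x hS
  have h2 := h.weight_ne_top hS
  simp [ENNReal.rpow_eq_zero_iff, h1, h2] at hx

/-- Every supersolution `v` with `∫ v^p w < ∞` is at least `c w (∫ v^p w + l)`. Integrating the
`p`-th power of this bound controls `∫ v^p w + l`, as `p > 1`. -/
theorem add_le_aprioriBound (h : IsWeightedKernel ν S g w c C) (hp : 1 < p) {μ : Measure E}
    (hμ : ∀ᵐ x ∂μ, x ∈ S) (hμ1 : ∫⁻ x, w x ∂μ = 1) {l : ℝ≥0∞} (hl : l ≠ 0) (hl' : l ≠ ⊤)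
    {v : E → ℝ≥0∞} (hvm : AEMeasurable v ν)
    (hv : ∀ᵐ x ∂ν, ∫⁻ y, g x y * v y ^ p ∂ν + l * potential g μ x ≤ v x)
    (hX : ∫⁻ x, v x ^ p * w x ∂ν ≠ ⊤) :
    ∫⁻ x, v x ^ p * w x ∂ν + l ≤ aprioriBound ν w c p := by
  set X := ∫⁻ x, v x ^ p * w x ∂ν with hXdef
  have hp0 : 0 < p := by linarith
  have hlow : ∀ᵐ x ∂ν, c * (w x * (X + l)) ≤ v x := by
    filter_upwards [hv, h.ae_mem] with x hx hS
    refine le_trans ?_ hx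
    rw [mul_add, mul_add]
    refine add_le_add ?_ ?_
    · rw [hXdef, ← mul_assoc, ← lintegral_const_mul'' _ (show AEMeasurable (fun y => v y ^ p * w y) ν
        from (hvm.pow_const p).mul h.measurable_weight.aemeasurable)]
      refine lintegral_mono_ae ?_
      filter_upwards [h.ae_mem] with y hy
      calc c * w x * (v y ^ p * w y) = c * (w x * w y) * v y ^ p := by ring
        _ ≤ _ := by gcongr; exact h.le_kernel x hS y hy
    · have := h.le_potential hμ hS
      rw [hμ1, mul_one] at this
      calc c * (w x * l) = l * (c * w x) := by ring
        _ ≤ _ := by gcongr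
  set Y := X + l with hY
  have hY0 : Y ≠ 0 := by simp [hY, hl]
  have hYt : Y ≠ ⊤ := by simp [hY, hX, hl']
  have h1 : c ^ p * (∫⁻ x, w x ^ p * w x ∂ν) * Y ^ p ≤ Y := by
    calc c ^ p * (∫⁻ x, w x ^ p * w x ∂ν) * Y ^ p
        = (c ^ p * Y ^ p) * ∫⁻ x, w x ^ p * w x ∂ν := by ring
      _ = ∫⁻ x, (c ^ p * Y ^ p) * (w x ^ p * w x) ∂ν :=
          (lintegral_const_mul _ ((h.measurable_weight.pow_const p).mul h.measurable_weight)).symm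
      _ ≤ X := by
          refine lintegral_mono_ae ?_
          filter_upwards [hlow] with x hx
          calc c ^ p * Y ^ p * (w x ^ p * w x) = (c * (w x * Y)) ^ p * w x := by
                rw [ENNReal.mul_rpow_of_nonneg _ _ hp0.le, ENNReal.mul_rpow_of_nonneg _ _ hp0.le]
                ring
            _ ≤ v x ^ p * w x := by gcongr
      _ ≤ Y := le_self_add
  have h2 : (c ^ p * ∫⁻ x, w x ^ p * w x ∂ν) * Y ^ (p - 1) ≤ 1 := by
    have e : Y ^ p = Y ^ (p - 1) * Y := by
      conv_lhs => rw [show p = (p - 1) + 1 by ring, ENNReal.rpow_add _ _ hY0 hYt, ENNReal.rpow_one]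
    rw [e, ← mul_assoc] at h1
    rw [← ENNReal.mul_le_mul_iff_left hY0 hYt, one_mul]
    exact h1
  rw [mul_comm, ← ENNReal.le_inv_iff_mul_le] at h2
  have h3 := ENNReal.rpow_le_rpow h2 (show 0 ≤ 1 / (p - 1) by apply one_div_nonneg.2; linarith)
  rwa [← ENNReal.rpow_mul, mul_one_div_cancel (by linarith), ENNReal.rpow_one] at h3

end IsWeightedKernel
end Abstract

/-! ### The threshold in the subcritical range -/

section Abstract
variable {E : Type*} [MeasurableSpace E]
variable {ν : Measure E} {S : Set E} {g : E → E → ℝ≥0∞} {w : E → ℝ≥0∞} {c C : ℝ≥0∞}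
  {p : ℝ}

namespace IsWeightedKernel

theorem weight_le_potential (h : IsWeightedKernel ν S g w c C) {μ : Measure E}
    (hμ : ∀ᵐ x ∂μ, x ∈ S) (hμ1 : ∫⁻ x, w x ∂μ = 1) {x : E} (hx : x ∈ S) :
    w x ≤ c⁻¹ * potential g μ x := by
  have := h.le_potential hμ hx
  rw [hμ1, mul_one] at this
  calc w x = c⁻¹ * (c * w x) := by
        rw [← mul_assoc, ENNReal.inv_mul_cancel h.lower_ne_zero h.lower_ne_top, one_mul]
    _ ≤ _ := by gcongr

/-- The part of `u ^ p` on the set `{u > n w}` has small weighted norm for large `n`. -/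
theorem tendsto_lintegral_indicator (h : IsWeightedKernel ν S g w c C) (hp : 0 < p)
    {u : E → ℝ≥0∞} (hu : Measurable u) (hX : ∫⁻ x, u x ^ p * w x ∂ν ≠ ⊤) :
    Tendsto (fun n : ℕ => ∫⁻ x, {x | n * w x < u x}.indicator (fun x => u x ^ p) x * w x ∂ν)
      atTop (𝓝 0) := by
  have hE : ∀ n : ℕ, MeasurableSet {x | n * w x < u x} := fun n =>
    measurableSet_lt (h.measurable_weight.const_mul _) hu
  rw [← lintegral_zero (μ := ν)]
  refine tendsto_lintegral_of_dominated_convergence (fun x => u x ^ p * w x)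
    (fun n => ((hu.pow_const p).indicator (hE n)).mul h.measurable_weight)
    (fun n => Eventually.of_forall fun x => ?_) hX ?_
  · dsimp only
    gcongr
    exact Set.indicator_le_self _ _ x
  · filter_upwards [h.ae_lt_top_of_lintegral_ne_top hu.aemeasurable hp hX, h.ae_mem] with x hx hS
    have hw := h.weight_ne_zero x hS
    obtain ⟨n, hn⟩ := ENNReal.exists_nat_mul_gt hw hx.ne
    refine tendsto_const_nhds.congr' ?_
    filter_upwards [eventually_ge_atTop n] with m hm
    have : x ∉ {x | (m : ℝ≥0∞) * w x < u x} := by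
      simp only [Set.mem_ofPred_eq, not_lt]
      refine hn.le.trans ?_
      gcongr
    simp [Set.indicator_of_notMem this]

/-- A solution with finite weighted norm is controlled by the potential of the datum. The part of
`u ^ p` where `u` exceeds a large multiple of the weight has small norm, so that its potential can
be absorbed by the three-point estimate. -/
theorem exists_le_potential (h : IsWeightedKernel ν S g w c C) [SFinite ν] (hp : 1 < p)
    {K : ℝ≥0∞} (hK : IsSubcritical ν S g w p K) {μ : Measure E} [SFinite μ]
    (hμ : ∀ᵐ x ∂μ, x ∈ S) (hμ1 : ∫⁻ x, w x ∂μ = 1) {l : ℝ≥0∞} (hl' : l ≠ ⊤)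
    {u : E → ℝ≥0∞} (hum : Measurable u)
    (hu : ∀ᵐ x ∂ν, u x = ∫⁻ y, g x y * u y ^ p ∂ν + l * potential g μ x)
    (hX : ∫⁻ x, u x ^ p * w x ∂ν ≠ ⊤) :
    ∃ A : ℝ≥0∞, A ≠ ⊤ ∧ ∀ᵐ x ∂ν, u x ≤ A * potential g μ x := by
  have hp0 : 0 < p := by linarith
  set E' : ℕ → Set E := fun n => {x | n * w x < u x} with hE'
  set φ : ℕ → E → ℝ≥0∞ := fun n => (E' n).indicator fun x => u x ^ p with hφ
  have hE : ∀ n : ℕ, MeasurableSet (E' n) := fun n =>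
    measurableSet_lt (h.measurable_weight.const_mul _) hum
  have hφm : ∀ n, Measurable (φ n) := fun n => (hum.pow_const p).indicator (hE n)
  have hlim := h.tendsto_lintegral_indicator hp0 hum hX
  -- the constant in front of the potential of the truncated source
  set D : ℝ≥0∞ := 2 ^ (p - 1) * K with hD
  have hDt : D ≠ ⊤ := ENNReal.mul_ne_top
    (ENNReal.rpow_ne_top_of_nonneg (by linarith) (by simp)) hK.ne_top
  have hlim2 : Tendsto (fun n : ℕ => D * (∫⁻ x, φ n x * w x ∂ν) ^ (p - 1)) atTop (𝓝 0) := by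
    have h1 : Tendsto (fun n : ℕ => (∫⁻ x, φ n x * w x ∂ν) ^ (p - 1)) atTop (𝓝 0) := by
      have := ((ENNReal.continuous_rpow_const (y := p - 1)).tendsto 0).comp hlim
      rwa [ENNReal.zero_rpow_of_pos (by linarith)] at this
    have := ENNReal.Tendsto.const_mul h1 (Or.inr hDt)
    rwa [mul_zero] at this
  obtain ⟨n, hn⟩ := (hlim2.eventually_le_const (show (0 : ℝ≥0∞) < 2⁻¹ by simp)).exists
  have hsW : ∫⁻ z, w z ∂(ν.withDensity (φ n)) = ∫⁻ x, φ n x * w x ∂ν := by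
    rw [lintegral_withDensity_eq_lintegral_mul _ (hφm n) h.measurable_weight]; rfl
  have hmem : ∀ᵐ x ∂(ν.withDensity (φ n)), x ∈ S :=
    (withDensity_absolutelyContinuous ν (φ n)).ae_le h.ae_mem
  set W := potential g (ν.withDensity (φ n)) with hW
  have hWm : Measurable W := h.measurable_potential _
  have hWeq : ∀ x, W x = ∫⁻ y, g x y * φ n y ∂ν :=
    fun x => h.potential_withDensity (hφm n).aemeasurable x
  set P := potential g μ with hP
  have hPm : Measurable P := h.measurable_potential μ
  have hWle : ∀ x, W x ≤ ∫⁻ y, g x y * u y ^ p ∂ν := by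
    intro x
    rw [hWeq]
    gcongr with y
    exact Set.indicator_le_self _ _ y
  -- the truncated source is a bounded multiple of the weight
  have hrest : ∀ y ∈ S, u y ^ p ≤ φ n y + (n : ℝ≥0∞) ^ p * C ^ (p - 1) * w y := by
    intro y hy
    by_cases hyE : y ∈ E' n
    · simp [hφ, hyE]
    · have hyn : u y ≤ n * w y := not_lt.1 hyE
      refine le_trans ?_ le_add_self
      calc u y ^ p ≤ (n * w y) ^ p := by gcongr
        _ = (n : ℝ≥0∞) ^ p * (w y ^ (p - 1) * w y) := by
            rw [ENNReal.mul_rpow_of_nonneg _ _ hp0.le]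
            congr 1
            conv_lhs => rw [show p = (p - 1) + 1 by ring, ENNReal.rpow_add _ _
              (h.weight_ne_zero y hy) (h.weight_ne_top hy), ENNReal.rpow_one]
        _ ≤ (n : ℝ≥0∞) ^ p * (C ^ (p - 1) * w y) := by
            gcongr
            exact h.weight_le y hy
        _ = _ := by ring
  set B : ℝ≥0∞ := (n : ℝ≥0∞) ^ p * C ^ (p - 1) * C * c⁻¹ + l with hB
  have hBt : B ≠ ⊤ := by
    refine ENNReal.add_ne_top.2 ⟨ENNReal.mul_ne_top (ENNReal.mul_ne_top (ENNReal.mul_ne_top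
      (ENNReal.rpow_ne_top_of_nonneg hp0.le (by simp))
      (ENNReal.rpow_ne_top_of_nonneg (by linarith) h.upper_ne_top)) h.upper_ne_top) ?_, hl'⟩
    simpa using h.lower_ne_zero
  have huW : ∀ᵐ x ∂ν, u x ≤ W x + B * P x := by
    filter_upwards [hu, h.ae_mem] with x hx hS
    calc u x = ∫⁻ y, g x y * u y ^ p ∂ν + l * P x := hx
      _ ≤ (∫⁻ y, g x y * φ n y + (n : ℝ≥0∞) ^ p * C ^ (p - 1) * (g x y * w y) ∂ν) + l * P x := by
          gcongr ?_ + _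
          refine lintegral_mono_ae ?_
          filter_upwards [h.ae_mem] with y hy
          calc g x y * u y ^ p ≤ g x y * (φ n y + (n : ℝ≥0∞) ^ p * C ^ (p - 1) * w y) := by
                gcongr; exact hrest y hy
            _ = _ := by ring
      _ = W x + (n : ℝ≥0∞) ^ p * C ^ (p - 1) * (∫⁻ y, g x y * w y ∂ν) + l * P x := by
          rw [lintegral_add_left (show Measurable fun y => g x y * φ n y from
              (h.measurable_section x).mul (hφm n)), hWeq,
            lintegral_const_mul _ (show Measurable fun y => g x y * w y from
              (h.measurable_section x).mul h.measurable_weight)]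
      _ ≤ W x + (n : ℝ≥0∞) ^ p * C ^ (p - 1) * (C * (c⁻¹ * P x)) + l * P x := by
          gcongr
          exact (h.lintegral_le x hS).trans (by gcongr; exact h.weight_le_potential hμ hμ1 hS)
      _ = W x + B * P x := by rw [hB]; ring
  have hWW : ∀ᵐ x ∂ν, W x ≤ 2⁻¹ * W x + D * B ^ p * P x := by
    filter_upwards [h.ae_mem] with x hS
    calc W x ≤ ∫⁻ y, g x y * u y ^ p ∂ν := hWle x
      _ ≤ ∫⁻ y, 2 ^ (p - 1) * (g x y * W y ^ p) + 2 ^ (p - 1) * B ^ p * (g x y * P y ^ p) ∂ν := by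
          refine lintegral_mono_ae ?_
          filter_upwards [huW] with y hy
          calc g x y * u y ^ p ≤ g x y * (2 ^ (p - 1) * (W y ^ p + (B * P y) ^ p)) := by
                gcongr
                exact (ENNReal.rpow_le_rpow hy hp0.le).trans
                  (ENNReal.rpow_add_le_mul_rpow_add_rpow _ _ hp.le)
            _ = _ := by rw [ENNReal.mul_rpow_of_nonneg _ _ hp0.le]; ring
      _ = 2 ^ (p - 1) * (∫⁻ y, g x y * W y ^ p ∂ν)
            + 2 ^ (p - 1) * B ^ p * (∫⁻ y, g x y * P y ^ p ∂ν) := by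
          have m1 : Measurable fun y => g x y * W y ^ p :=
            (h.measurable_section x).mul (hWm.pow_const p)
          have m2 : Measurable fun y => g x y * P y ^ p :=
            (h.measurable_section x).mul (hPm.pow_const p)
          rw [lintegral_add_left (m1.const_mul _), lintegral_const_mul _ m1,
            lintegral_const_mul _ m2]
      _ ≤ 2 ^ (p - 1) * (K * (∫⁻ x, φ n x * w x ∂ν) ^ (p - 1) * W x)
            + 2 ^ (p - 1) * B ^ p * (K * (1 : ℝ≥0∞) ^ (p - 1) * P x) := by
          gcongr
          · rw [← hsW]
            exact h.potential_potential_rpow_le hp hK hmem hS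
          · rw [← hμ1]
            exact h.potential_potential_rpow_le hp hK hμ hS
      _ = D * (∫⁻ x, φ n x * w x ∂ν) ^ (p - 1) * W x + D * B ^ p * P x := by
          rw [ENNReal.one_rpow, hD]; ring
      _ ≤ _ := by gcongr
  refine ⟨2 * (D * B ^ p) + B, ?_, ?_⟩
  · exact ENNReal.add_ne_top.2 ⟨ENNReal.mul_ne_top (by simp) (ENNReal.mul_ne_top hDt
      (ENNReal.rpow_ne_top_of_nonneg hp0.le hBt)), hBt⟩
  · filter_upwards [hWW, huW, hu, h.ae_lt_top_of_lintegral_ne_top hum.aemeasurable hp0 hX]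
      with x h1 h2 h3 h4
    -- finiteness of `W x` is what allows subtracting `W x / 2` from both sides
    have hWt : W x ≠ ⊤ := ((hWle x).trans (h3 ▸ le_self_add)).trans_lt h4 |>.ne
    have h5 : 2⁻¹ * W x ≤ D * B ^ p * P x := by
      have e : W x = 2⁻¹ * W x + 2⁻¹ * W x := by
        rw [← add_mul, ENNReal.inv_two_add_inv_two, one_mul]
      have hh : 2⁻¹ * W x ≠ ⊤ := ENNReal.mul_ne_top (by simp) hWt
      nth_rewrite 1 [e] at h1
      exact (ENNReal.add_le_add_iff_left hh).1 h1
    have h6 : W x ≤ 2 * (D * B ^ p * P x) := by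
      calc W x = 2 * (2⁻¹ * W x) := by
            rw [← mul_assoc, ENNReal.mul_inv_cancel (by simp) (by simp), one_mul]
        _ ≤ _ := by gcongr
    calc u x ≤ W x + B * P x := h2
      _ ≤ 2 * (D * B ^ p * P x) + B * P x := by gcongr
      _ = _ := by ring

/-- For small `l` the function `2 l 𝔾[μ]` is a supersolution, so the least solution has finite
weighted norm. -/
theorem leastSolution_ne_top_of_small (h : IsWeightedKernel ν S g w c C) [SFinite ν] (hp : 1 < p)
    {K : ℝ≥0∞} (hK : IsSubcritical ν S g w p K) {μ : Measure E} [SFinite μ]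
    (hμ : ∀ᵐ x ∂μ, x ∈ S) (hμ1 : ∫⁻ x, w x ∂μ = 1) :
    ∃ l : ℝ, 0 < l ∧ ∫⁻ x, leastSolution g ν p
      (fun x => ENNReal.ofReal l * potential g μ x) x ^ p * w x ∂ν ≠ ⊤ := by
  have hp0 : 0 < p := by linarith
  have hPm : Measurable (potential g μ) := h.measurable_potential μ
  -- `t` is chosen so that `t ^ p * K ≤ t / 2`; the summand `1` avoids a division by zero
  set k := K.toReal + 1
  have hk : 0 < k := by positivity
  set t : ℝ := (1 / (2 * k)) ^ (1 / (p - 1)) with ht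
  have ht0 : 0 < t := by positivity
  have htp : t ^ p * k = t / 2 := by
    have : t ^ (p - 1) = 1 / (2 * k) := by
      rw [ht, ← Real.rpow_mul (by positivity), one_div_mul_cancel (by linarith), Real.rpow_one]
    rw [show p = (p - 1) + 1 by ring, Real.rpow_add ht0, Real.rpow_one, this]
    field_simp
  have hKt : ENNReal.ofReal t ^ p * K ≤ ENNReal.ofReal (t / 2) := by
    rw [← htp, ENNReal.ofReal_rpow_of_pos ht0, ENNReal.ofReal_mul (by positivity)]
    gcongr
    rw [← ENNReal.ofReal_toReal hK.ne_top]
    exact ENNReal.ofReal_le_ofReal (by simp [k])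
  refine ⟨t / 2, by positivity, ?_⟩
  have hle : ∀ᵐ x ∂ν, leastSolution g ν p (fun x => ENNReal.ofReal (t / 2) * potential g μ x) x
      ≤ ENNReal.ofReal t * potential g μ x := by
    refine leastSolution_le hp0.le ?_
    filter_upwards [h.ae_mem] with x hS
    calc ∫⁻ y, g x y * (ENNReal.ofReal t * potential g μ y) ^ p ∂ν
          + ENNReal.ofReal (t / 2) * potential g μ x
        = ENNReal.ofReal t ^ p * (∫⁻ y, g x y * potential g μ y ^ p ∂ν)
          + ENNReal.ofReal (t / 2) * potential g μ x := by
          rw [← lintegral_const_mul _ (show Measurable fun y => g x y * potential g μ y ^ p from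
            (h.measurable_section x).mul (hPm.pow_const p))]
          congr 1
          refine lintegral_congr fun y => ?_
          rw [ENNReal.mul_rpow_of_nonneg _ _ hp0.le]; ring
      _ ≤ ENNReal.ofReal t ^ p * (K * (1 : ℝ≥0∞) ^ (p - 1) * potential g μ x)
          + ENNReal.ofReal (t / 2) * potential g μ x := by
          gcongr
          rw [← hμ1]
          exact h.potential_potential_rpow_le hp hK hμ hS
      _ = (ENNReal.ofReal t ^ p * K + ENNReal.ofReal (t / 2)) * potential g μ x := by
          rw [ENNReal.one_rpow]; ring
      _ ≤ (ENNReal.ofReal (t / 2) + ENNReal.ofReal (t / 2)) * potential g μ x := by gcongr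
      _ = _ := by rw [← ENNReal.ofReal_add (by positivity) (by positivity), add_halves]
  refine ne_top_of_le_ne_top (b := ENNReal.ofReal t ^ p * K) ?_ ?_
  · exact ne_top_of_le_ne_top ENNReal.ofReal_ne_top hKt
  · calc _ ≤ ∫⁻ x, ENNReal.ofReal t ^ p * (potential g μ x ^ p * w x) ∂ν := by
          refine lintegral_mono_ae ?_
          filter_upwards [hle] with x hx
          rw [← mul_assoc, ← ENNReal.mul_rpow_of_nonneg _ _ hp0.le]
          gcongr
      _ = ENNReal.ofReal t ^ p * ∫⁻ x, potential g μ x ^ p * w x ∂ν :=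
          lintegral_const_mul _ ((hPm.pow_const p).mul h.measurable_weight)
      _ ≤ ENNReal.ofReal t ^ p * K := by
          gcongr
          have := h.lintegral_potential_rpow_le hp hK hμ
          simpa [hμ1] using this

/-- The set of admissible `λ` is closed under increasing limits: the least solutions increase to a
supersolution, and their weighted norms are uniformly bounded. -/
theorem leastSolution_ne_top_of_tendsto (h : IsWeightedKernel ν S g w c C) [SFinite ν] (hp : 1 < p)
    {μ : Measure E} [SFinite μ] (hμ : ∀ᵐ x ∂μ, x ∈ S) (hμ1 : ∫⁻ x, w x ∂μ = 1)
    {t : ℕ → ℝ} {l : ℝ} (ht : Monotone t) (htl : Tendsto t atTop (𝓝 l)) (ht0 : ∀ n, 0 < t n)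
    (hfin : ∀ n, ∫⁻ x, leastSolution g ν p
      (fun x => ENNReal.ofReal (t n) * potential g μ x) x ^ p * w x ∂ν ≠ ⊤) :
    ∫⁻ x, leastSolution g ν p
      (fun x => ENNReal.ofReal l * potential g μ x) x ^ p * w x ∂ν ≠ ⊤ := by
  have hp0 : 0 < p := by linarith
  have hPm : Measurable (potential g μ) := h.measurable_potential μ
  set U : ℝ → E → ℝ≥0∞ := fun a =>
    leastSolution g ν p (fun x => ENNReal.ofReal a * potential g μ x) with hU
  have hUm : ∀ a, Measurable (U a) := fun a => h.measurable_leastSolution (hPm.const_mul _)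
  have hUeq : ∀ a x, U a x = ∫⁻ y, g x y * U a y ^ p ∂ν + ENNReal.ofReal a * potential g μ x :=
    fun a x => h.leastSolution_eq (hPm.const_mul _) hp0 x
  have hUmono : ∀ x, Monotone fun n => U (t n) x := fun x i j hij =>
    leastSolution_mono_source hp0.le (fun y => by gcongr; exact ht hij) x
  have hsup : ENNReal.ofReal l = ⨆ n, ENNReal.ofReal (t n) :=
    tendsto_nhds_unique (ENNReal.tendsto_ofReal htl)
      (tendsto_atTop_iSup fun i j hij => ENNReal.ofReal_le_ofReal (ht hij))
  have hle : ∀ᵐ x ∂ν, U l x ≤ ⨆ n, U (t n) x := by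
    refine leastSolution_le hp0.le (Eventually.of_forall fun x => ?_)
    have e : ∫⁻ y, g x y * (⨆ n, U (t n) y) ^ p ∂ν = ⨆ n, ∫⁻ y, g x y * U (t n) y ^ p ∂ν := by
      rw [← lintegral_iSup]
      · refine lintegral_congr fun y => ?_
        rw [iSup_rpow _ hp0, ENNReal.mul_iSup]
      · exact fun n => (h.measurable_section x).mul ((hUm _).pow_const p)
      · intro i j hij y
        have := hUmono y hij
        dsimp only at this ⊢
        gcongr
    rw [e, hsup, ENNReal.iSup_mul, ENNReal.iSup_add_iSup_of_monotone]
    · exact iSup_mono fun n => (hUeq _ x).ge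
    · intro i j hij
      dsimp only
      gcongr with y
      exact hUmono y hij
    · intro i j hij
      dsimp only
      gcongr
      exact ht hij
  refine ne_top_of_le_ne_top (h.aprioriBound_ne_top hp) ?_
  calc ∫⁻ x, U l x ^ p * w x ∂ν ≤ ∫⁻ x, ⨆ n, U (t n) x ^ p * w x ∂ν := by
        refine lintegral_mono_ae ?_
        filter_upwards [hle] with x hx
        rw [← ENNReal.iSup_mul, ← iSup_rpow _ hp0]
        gcongr
    _ = ⨆ n, ∫⁻ x, U (t n) x ^ p * w x ∂ν := by
        rw [lintegral_iSup]
        · exact fun n => ((hUm _).pow_const p).mul h.measurable_weight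
        · intro i j hij y
          have := hUmono y hij
          dsimp only at this ⊢
          gcongr
    _ ≤ _ := iSup_le fun n => le_self_add.trans (h.add_le_aprioriBound hp hμ hμ1
        (by simpa using ht0 n) ENNReal.ofReal_ne_top (hUm _).aemeasurable
        (Eventually.of_forall fun x => (hUeq _ x).ge) (hfin n))

/-- The least solution has finite weighted norm exactly up to a threshold, at which it is bounded by
a multiple of the potential of the datum. By convexity the bound for smaller parameters is
proportional to the parameter. -/
theorem exists_threshold (h : IsWeightedKernel ν S g w c C) [SFinite ν] (hp : 1 < p)
    {K : ℝ≥0∞} (hK : IsSubcritical ν S g w p K) {μ : Measure E} [SFinite μ]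
    (hμ : ∀ᵐ x ∂μ, x ∈ S) (hμ1 : ∫⁻ x, w x ∂μ = 1) :
    ∃ lamStar A : ℝ, 0 < lamStar ∧ 0 < A ∧
      (∀ l ∈ Set.Ioc 0 lamStar,
        ∫⁻ x, leastSolution g ν p
          (fun x => ENNReal.ofReal l * potential g μ x) x ^ p * w x ∂ν ≠ ⊤ ∧
        ∀ᵐ x ∂ν, leastSolution g ν p (fun x => ENNReal.ofReal l * potential g μ x) x
          ≤ ENNReal.ofReal (A * l) * potential g μ x) ∧
      ∀ l, lamStar < l → ∀ v : E → ℝ≥0∞,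
        (∀ᵐ x ∂ν, ∫⁻ y, g x y * v y ^ p ∂ν + ENNReal.ofReal l * potential g μ x ≤ v x) →
        ∫⁻ x, v x ^ p * w x ∂ν = ⊤ := by
  have hp0 : 0 < p := by linarith
  have hPm : Measurable (potential g μ) := h.measurable_potential μ
  set U : ℝ → E → ℝ≥0∞ := fun a =>
    leastSolution g ν p (fun x => ENNReal.ofReal a * potential g μ x) with hU
  have hUm : ∀ a, Measurable (U a) := fun a => h.measurable_leastSolution (hPm.const_mul _)
  have hUeq : ∀ a x, U a x = ∫⁻ y, g x y * U a y ^ p ∂ν + ENNReal.ofReal a * potential g μ x :=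
    fun a x => h.leastSolution_eq (hPm.const_mul _) hp0 x
  have hUmono : ∀ x, Monotone fun a => U a x := fun x i j hij =>
    leastSolution_mono_source hp0.le (fun y => by gcongr) x
  set L : Set ℝ := {l | 0 < l ∧ ∫⁻ x, U l x ^ p * w x ∂ν ≠ ⊤} with hL
  have hLne : L.Nonempty := h.leastSolution_ne_top_of_small hp hK hμ hμ1
  have hLb : BddAbove L := by
    refine ⟨(aprioriBound ν w c p).toReal, ?_⟩
    rintro l ⟨hl0, hl⟩
    rw [← ENNReal.ofReal_le_iff_le_toReal (h.aprioriBound_ne_top hp)]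
    exact le_add_self.trans (h.add_le_aprioriBound hp hμ hμ1 (by simpa using hl0)
      ENNReal.ofReal_ne_top (hUm _).aemeasurable
      (Eventually.of_forall fun x => (hUeq _ x).ge) hl)
  have hdown : ∀ l ∈ L, ∀ l', 0 < l' → l' ≤ l → l' ∈ L := by
    rintro l ⟨-, hl⟩ l' h0 hll
    refine ⟨h0, ne_top_of_le_ne_top hl ?_⟩
    gcongr with x
    exact hUmono x hll
  obtain ⟨t, htm, htl, htL⟩ := exists_seq_tendsto_sSup hLne hLb
  set lamStar := sSup L
  have hpos : 0 < lamStar := by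
    obtain ⟨l, hl⟩ := hLne
    exact hl.1.trans_le (le_csSup hLb hl)
  have hstar : lamStar ∈ L := ⟨hpos, h.leastSolution_ne_top_of_tendsto hp hμ hμ1 htm htl
    (fun n => (htL n).1) (fun n => (htL n).2)⟩
  obtain ⟨A, hAt, hA⟩ := h.exists_le_potential hp hK hμ hμ1 ENNReal.ofReal_ne_top (hUm lamStar)
    (Eventually.of_forall fun x => hUeq lamStar x) hstar.2
  refine ⟨lamStar, (A.toReal + 1) / lamStar, hpos, by positivity, ?_, ?_⟩
  · rintro l ⟨hl0, hl⟩
    refine ⟨(hdown _ hstar l hl0 hl).2, ?_⟩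
    -- convexity: the least solution for `θ λ*` lies below `θ` times the one for `λ*`
    set θ := l / lamStar with hθ
    have hθ0 : 0 < θ := by positivity
    have hθ1 : ENNReal.ofReal θ ≤ 1 := by
      rw [← ENNReal.ofReal_one]
      exact ENNReal.ofReal_le_ofReal ((div_le_one hpos).2 hl)
    have hθp : ENNReal.ofReal θ ^ p ≤ ENNReal.ofReal θ := by
      calc ENNReal.ofReal θ ^ p ≤ ENNReal.ofReal θ ^ (1 : ℝ) :=
            ENNReal.rpow_le_rpow_of_exponent_ge hθ1 hp.le
        _ = _ := ENNReal.rpow_one _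
    have hle : ∀ᵐ x ∂ν, U l x ≤ ENNReal.ofReal θ * U lamStar x := by
      refine leastSolution_le hp0.le (Eventually.of_forall fun x => ?_)
      have hlθ : ENNReal.ofReal l = ENNReal.ofReal θ * ENNReal.ofReal lamStar := by
        rw [← ENNReal.ofReal_mul hθ0.le, hθ, div_mul_cancel₀ _ hpos.ne']
      calc ∫⁻ y, g x y * (ENNReal.ofReal θ * U lamStar y) ^ p ∂ν
            + ENNReal.ofReal l * potential g μ x
          ≤ ∫⁻ y, ENNReal.ofReal θ * (g x y * U lamStar y ^ p) ∂ν
            + ENNReal.ofReal θ * (ENNReal.ofReal lamStar * potential g μ x) := by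
            rw [hlθ, mul_assoc]
            refine add_le_add (lintegral_mono fun y => ?_) le_rfl
            rw [ENNReal.mul_rpow_of_nonneg _ _ hp0.le, mul_left_comm]
            gcongr
        _ = ENNReal.ofReal θ * U lamStar x := by
            rw [lintegral_const_mul _ (show Measurable fun y => g x y * U lamStar y ^ p from
              (h.measurable_section x).mul ((hUm _).pow_const p)), ← mul_add, ← hUeq]
    filter_upwards [hle, hA] with x h1 h2
    calc U l x ≤ ENNReal.ofReal θ * U lamStar x := h1
      _ ≤ ENNReal.ofReal θ * (A * potential g μ x) := by gcongr
      _ ≤ ENNReal.ofReal θ * (ENNReal.ofReal (A.toReal + 1) * potential g μ x) := by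
          gcongr
          rw [← ENNReal.ofReal_toReal hAt, ENNReal.toReal_ofReal ENNReal.toReal_nonneg]
          exact ENNReal.ofReal_le_ofReal (by simp)
      _ = _ := by
          rw [← mul_assoc, ← ENNReal.ofReal_mul hθ0.le]
          congr 2
          rw [hθ]; ring
  · intro l hl v hv
    by_contra hfin
    have hlL : l ∈ L := by
      refine ⟨hpos.trans hl, ne_top_of_le_ne_top hfin ?_⟩
      refine lintegral_mono_ae ?_
      filter_upwards [leastSolution_le hp0.le hv] with x hx
      gcongr
    exact absurd (le_csSup hLb hlL) (not_le.2 hl)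

end IsWeightedKernel
end Abstract

/-! ### The quasi-metric behind the model kernel -/

section Kernel
variable {N : ℕ} {Ω : Set (Eucl N)} {s γ : ℝ}

theorem bdist_nonneg (x : Eucl N) : 0 ≤ bdist Ω x := Metric.infDist_nonneg

theorem bdist_le_add (x y : Eucl N) : bdist Ω x ≤ bdist Ω y + ‖x - y‖ := by
  rw [← dist_eq_norm]; exact Metric.infDist_le_infDist_add_dist

theorem continuous_bdist : Continuous (bdist Ω) := Metric.continuous_infDist_pt _

theorem IsBoundedC2Domain.frontier_nonempty (hΩ : IsBoundedC2Domain Ω) (hN : 0 < N) :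
    (frontier Ω).Nonempty := by
  have : Nonempty (Fin N) := ⟨⟨0, hN⟩⟩
  rw [nonempty_frontier_iff]
  refine ⟨hΩ.isConnected.nonempty, fun h => ?_⟩
  have := hΩ.isBounded
  rw [h] at this
  exact NormedSpace.unbounded_univ ℝ (Eucl N) this

theorem IsBoundedC2Domain.bdist_pos (hΩ : IsBoundedC2Domain Ω) (hN : 0 < N) {x : Eucl N}
    (hx : x ∈ Ω) : 0 < bdist Ω x := by
  refine (isClosed_frontier.notMem_iff_infDist_pos (hΩ.frontier_nonempty hN)).1 fun h => ?_
  have := hΩ.isOpen.inter_frontier_eq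
  exact (this ▸ (⟨hx, h⟩ : x ∈ Ω ∩ frontier Ω) : x ∈ (∅ : Set (Eucl N)))

theorem IsBoundedC2Domain.exists_diam_bound (hΩ : IsBoundedC2Domain Ω) (hN : 0 < N) :
    ∃ D : ℝ, 0 < D ∧ (∀ x ∈ Ω, ∀ y ∈ Ω, ‖x - y‖ < D) ∧ ∀ x ∈ Ω, bdist Ω x ≤ D := by
  obtain ⟨z, hz⟩ := hΩ.frontier_nonempty hN
  obtain ⟨R, hR⟩ := hΩ.isBounded.exists_norm_le
  obtain ⟨x₀, hx₀⟩ := hΩ.isConnected.nonempty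
  have hR0 : 0 ≤ R := (norm_nonneg _).trans (hR x₀ hx₀)
  refine ⟨2 * R + ‖z‖ + 1, by positivity, fun x hx y hy => ?_, fun x hx => ?_⟩
  · have := norm_sub_le x y
    have := hR x hx
    have := hR y hy
    have := norm_nonneg z
    linarith
  · have h1 : bdist Ω x ≤ dist x z := Metric.infDist_le_dist_of_mem hz
    rw [dist_eq_norm] at h1
    have := norm_sub_le x z
    have := hR x hx
    linarith

/-- The length scale `max (|x-y|, δ(x), δ(y))` of a pair of points. -/
noncomputable def pairScale (Ω : Set (Eucl N)) (x y : Eucl N) : ℝ :=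
  max ‖x - y‖ (max (bdist Ω x) (bdist Ω y))

/-- `|x-y|^{N-2s} max (|x-y|, δ(x), δ(y))^{2γ}`: a quasi-metric, the inverse of which is comparable
to the model kernel divided by `δ(x)^γ δ(y)^γ`. -/
noncomputable def quasiDist (Ω : Set (Eucl N)) (s γ : ℝ) (x y : Eucl N) : ℝ :=
  ‖x - y‖ ^ ((N : ℝ) - 2 * s) * pairScale Ω x y ^ (2 * γ)

theorem pairScale_nonneg (x y : Eucl N) : 0 ≤ pairScale Ω x y :=
  (norm_nonneg _).trans (le_max_left _ _)

theorem norm_le_pairScale (x y : Eucl N) : ‖x - y‖ ≤ pairScale Ω x y := le_max_left _ _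

theorem bdist_left_le_pairScale (x y : Eucl N) : bdist Ω x ≤ pairScale Ω x y :=
  (le_max_left _ _).trans (le_max_right _ _)

theorem bdist_right_le_pairScale (x y : Eucl N) : bdist Ω y ≤ pairScale Ω x y :=
  (le_max_right _ _).trans (le_max_right _ _)

theorem pairScale_comm (x y : Eucl N) : pairScale Ω x y = pairScale Ω y x := by
  unfold pairScale; rw [norm_sub_rev, max_comm (bdist Ω x)]

theorem quasiDist_comm (x y : Eucl N) : quasiDist Ω s γ x y = quasiDist Ω s γ y x := by
  unfold quasiDist; rw [norm_sub_rev, pairScale_comm]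

theorem quasiDist_pos {x y : Eucl N} (h : x ≠ y) : 0 < quasiDist Ω s γ x y := by
  have h1 : 0 < ‖x - y‖ := norm_pos_iff.2 (sub_ne_zero.2 h)
  exact mul_pos (Real.rpow_pos_of_pos h1 _)
    (Real.rpow_pos_of_pos (h1.trans_le (norm_le_pairScale _ _)) _)

theorem quasiDist_self (hN : 2 * s < N) (x : Eucl N) : quasiDist Ω s γ x x = 0 := by
  unfold quasiDist
  rw [sub_self, norm_zero, Real.zero_rpow (by linarith), zero_mul]

/-- If `y` is at least as far from `x` as from `z`, then `|x-z|` and `δ(z)` are controlled by the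
pair `(x, y)` alone, because `δ` is `1`-Lipschitz. -/
theorem quasiDist_le_of_norm_le (hN : 2 * s < N) (hγ : 0 < γ) {x y z : Eucl N}
    (h : ‖y - z‖ ≤ ‖x - y‖) :
    quasiDist Ω s γ x z ≤ 2 ^ ((N : ℝ) - 2 * s + 2 * γ) * quasiDist Ω s γ x y := by
  have h1 : ‖x - z‖ ≤ 2 * ‖x - y‖ := by
    have := norm_sub_le_norm_sub_add_norm_sub x y z
    linarith
  have h2 : pairScale Ω x z ≤ 2 * pairScale Ω x y := by
    have a1 := norm_le_pairScale (Ω := Ω) x y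
    have a2 := bdist_left_le_pairScale (Ω := Ω) x y
    have a3 := bdist_right_le_pairScale (Ω := Ω) x y
    have a4 := bdist_le_add (Ω := Ω) z y
    rw [norm_sub_rev] at a4
    have a5 := pairScale_nonneg (Ω := Ω) x y
    refine max_le ?_ (max_le ?_ ?_) <;> linarith
  unfold quasiDist
  calc ‖x - z‖ ^ ((N : ℝ) - 2 * s) * pairScale Ω x z ^ (2 * γ)
      ≤ (2 * ‖x - y‖) ^ ((N : ℝ) - 2 * s) * (2 * pairScale Ω x y) ^ (2 * γ) := by
        have := pairScale_nonneg (Ω := Ω) x z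
        exact mul_le_mul (Real.rpow_le_rpow (norm_nonneg _) h1 (by linarith))
          (Real.rpow_le_rpow this h2 (by linarith)) (by positivity) (by positivity)
    _ = _ := by
        rw [Real.mul_rpow (by norm_num) (norm_nonneg _),
          Real.mul_rpow (by norm_num) (pairScale_nonneg _ _), Real.rpow_add (by norm_num)]
        ring

/-- The inverse of the quasi-metric, infinite on the diagonal. -/
noncomputable def reducedKernel (Ω : Set (Eucl N)) (s γ : ℝ) (x y : Eucl N) : ℝ≥0∞ :=
  (ENNReal.ofReal (quasiDist Ω s γ x y))⁻¹

/-- The weight `δ^γ` as an extended number. -/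
noncomputable def weight (Ω : Set (Eucl N)) (γ : ℝ) (x : Eucl N) : ℝ≥0∞ :=
  ENNReal.ofReal (bdist Ω x ^ γ)

theorem reducedKernel_comm (x y : Eucl N) :
    reducedKernel Ω s γ x y = reducedKernel Ω s γ y x := by
  unfold reducedKernel; rw [quasiDist_comm]

theorem reducedKernel_le_of_norm_le (hN : 2 * s < N) (hγ : 0 < γ) {x y z : Eucl N}
    (h : ‖y - z‖ ≤ ‖x - y‖) :
    reducedKernel Ω s γ x y
      ≤ ENNReal.ofReal (2 ^ ((N : ℝ) - 2 * s + 2 * γ)) * reducedKernel Ω s γ x z := by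
  have h1 := ENNReal.ofReal_le_ofReal (quasiDist_le_of_norm_le (Ω := Ω) hN hγ h)
  have hk : (0 : ℝ) < 2 ^ ((N : ℝ) - 2 * s + 2 * γ) := by positivity
  rw [ENNReal.ofReal_mul hk.le] at h1
  unfold reducedKernel
  set k := ENNReal.ofReal (2 ^ ((N : ℝ) - 2 * s + 2 * γ))
  have hk0 : k ≠ 0 := by simpa [k] using hk
  have hkt : k ≠ ⊤ := ENNReal.ofReal_ne_top
  have h2 := ENNReal.inv_le_inv.2 h1
  rw [ENNReal.mul_inv (Or.inl hk0) (Or.inl hkt)] at h2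
  calc _ = k * (k⁻¹ * (ENNReal.ofReal (quasiDist Ω s γ x y))⁻¹) := by
        rw [← mul_assoc, ENNReal.mul_inv_cancel hk0 hkt, one_mul]
    _ ≤ _ := by gcongr

/-- The three-point inequality expressing that the inverse of the kernel is a quasi-metric. -/
theorem reducedKernel_mul_le (hN : 2 * s < N) (hγ : 0 < γ) (x y z : Eucl N) :
    reducedKernel Ω s γ x y * reducedKernel Ω s γ y z
      ≤ ENNReal.ofReal (2 ^ ((N : ℝ) - 2 * s + 2 * γ)) * reducedKernel Ω s γ x z
        * (reducedKernel Ω s γ x y + reducedKernel Ω s γ y z) := by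
  rcases le_total ‖y - z‖ ‖x - y‖ with h | h
  · exact mul_le_mul' (reducedKernel_le_of_norm_le hN hγ h) le_add_self
  · rw [norm_sub_rev, norm_sub_rev y z] at h
    have := reducedKernel_le_of_norm_le (Ω := Ω) hN hγ h
    rw [reducedKernel_comm z y, reducedKernel_comm z x] at this
    rw [mul_comm]
    exact mul_le_mul' this le_self_add

theorem measurable_weight (hγ : 0 ≤ γ) : Measurable (weight Ω γ) :=
  ((Real.continuous_rpow_const hγ).comp continuous_bdist).measurable.ennreal_ofReal

theorem measurable_quasiDist :
    Measurable fun q : Eucl N × Eucl N => quasiDist Ω s γ q.1 q.2 := by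
  have h1 : Measurable fun q : Eucl N × Eucl N => ‖q.1 - q.2‖ := by fun_prop
  have h2 : Measurable fun q : Eucl N × Eucl N => pairScale Ω q.1 q.2 :=
    h1.max ((continuous_bdist.measurable.comp measurable_fst).max
      (continuous_bdist.measurable.comp measurable_snd))
  exact (h1.pow_const _).mul (h2.pow_const _)

theorem measurable_reducedKernel :
    Measurable fun q : Eucl N × Eucl N => reducedKernel Ω s γ q.1 q.2 :=
  measurable_quasiDist.ennreal_ofReal.inv

theorem min_div_eq {δ r : ℝ} (hδ : 0 < δ) (hr : 0 < r) : min (δ / r) 1 = δ / max r δ := by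
  rcases le_total r δ with h | h
  · rw [max_eq_right h, div_self hδ.ne', min_eq_right ((one_le_div hr).2 h)]
  · rw [max_eq_left h, min_eq_left ((div_le_one hr).2 h)]

theorem modelKernel_eq {x y : Eucl N} (hx : 0 < bdist Ω x) (hy : 0 < bdist Ω y)
    (hxy : x ≠ y) :
    modelKernel Ω s γ x y = (‖x - y‖ ^ ((N : ℝ) - 2 * s))⁻¹ * (bdist Ω x ^ γ * bdist Ω y ^ γ)
      * ((max ‖x - y‖ (bdist Ω x) * max ‖x - y‖ (bdist Ω y)) ^ γ)⁻¹ := by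
  have hr : 0 < ‖x - y‖ := norm_pos_iff.2 (sub_ne_zero.2 hxy)
  unfold modelKernel
  rw [min_div_eq hx hr, min_div_eq hy hr, Real.div_rpow hx.le (by positivity),
    Real.div_rpow hy.le (by positivity), Real.mul_rpow (by positivity) (by positivity)]
  rw [mul_inv]
  ring

/-- The model kernel is `δ(x)^γ δ(y)^γ` divided by the quasi-metric, up to a factor `2^γ`. -/
theorem modelKernel_bounds {x y : Eucl N} (hγ : 0 < γ) (hx : 0 < bdist Ω x)
    (hy : 0 < bdist Ω y) (hxy : x ≠ y) :
    bdist Ω x ^ γ * bdist Ω y ^ γ * (quasiDist Ω s γ x y)⁻¹ ≤ modelKernel Ω s γ x y ∧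
    modelKernel Ω s γ x y
      ≤ 2 ^ γ * (bdist Ω x ^ γ * bdist Ω y ^ γ * (quasiDist Ω s γ x y)⁻¹) := by
  have hr : 0 < ‖x - y‖ := norm_pos_iff.2 (sub_ne_zero.2 hxy)
  rw [modelKernel_eq hx hy hxy]
  have e1 : (quasiDist Ω s γ x y)⁻¹
      = (‖x - y‖ ^ ((N : ℝ) - 2 * s))⁻¹ * ((pairScale Ω x y ^ 2) ^ γ)⁻¹ := by
    unfold quasiDist
    rw [mul_inv, Real.rpow_mul (pairScale_nonneg _ _), Real.rpow_two]
  set m := pairScale Ω x y with hm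
  set r := ‖x - y‖
  have hrm : r ≤ m := norm_le_pairScale x y
  have hm0 : 0 < m := hr.trans_le hrm
  have hxm : max r (bdist Ω x) ≤ m := max_le hrm (bdist_left_le_pairScale x y)
  have hym : max r (bdist Ω y) ≤ m := max_le hrm (bdist_right_le_pairScale x y)
  have hx0 : 0 < max r (bdist Ω x) := lt_max_of_lt_left hr
  have hy0 : 0 < max r (bdist Ω y) := lt_max_of_lt_left hr
  set q := max r (bdist Ω x) * max r (bdist Ω y) with hq
  have hq0 : 0 < q := mul_pos hx0 hy0
  have hqm : q ≤ m ^ 2 := by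
    rw [sq]; exact mul_le_mul hxm hym hy0.le hm0.le
  have hmq : m ^ 2 ≤ 2 * q := by
    have a1 : bdist Ω x ≤ bdist Ω y + r := bdist_le_add x y
    have a2 : bdist Ω y ≤ bdist Ω x + r := by
      have := bdist_le_add (Ω := Ω) y x
      rwa [norm_sub_rev] at this
    have b1 := le_max_left r (bdist Ω x)
    have b2 := le_max_right r (bdist Ω x)
    have b3 := le_max_left r (bdist Ω y)
    have b4 := le_max_right r (bdist Ω y)
    have hmx : m ≤ 2 * max r (bdist Ω x) := max_le (by linarith) (max_le (by linarith) (by linarith))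
    have hmy : m ≤ 2 * max r (bdist Ω y) := max_le (by linarith) (max_le (by linarith) (by linarith))
    rcases le_total (bdist Ω x) (bdist Ω y) with hle | hle
    · have : m ≤ max r (bdist Ω y) := max_le b3 (max_le (hle.trans b4) b4)
      nlinarith
    · have : m ≤ max r (bdist Ω x) := max_le b1 (max_le b2 (hle.trans b2))
      nlinarith
  have hA : 0 ≤ (r ^ ((N : ℝ) - 2 * s))⁻¹ * (bdist Ω x ^ γ * bdist Ω y ^ γ) := by positivity
  have i1 : ((m ^ 2) ^ γ)⁻¹ ≤ (q ^ γ)⁻¹ :=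
    inv_anti₀ (by positivity) (Real.rpow_le_rpow hq0.le hqm hγ.le)
  have i2 : (q ^ γ)⁻¹ ≤ 2 ^ γ * ((m ^ 2) ^ γ)⁻¹ := by
    have h3 : (m ^ 2) ^ γ ≤ 2 ^ γ * q ^ γ := by
      rw [← Real.mul_rpow (by norm_num) hq0.le]
      exact Real.rpow_le_rpow (by positivity) hmq hγ.le
    rw [← div_eq_mul_inv, le_div_iff₀ (by positivity), inv_mul_le_iff₀ (by positivity), mul_comm]
    exact h3
  rw [e1]
  constructor
  · calc _ = (r ^ ((N : ℝ) - 2 * s))⁻¹ * (bdist Ω x ^ γ * bdist Ω y ^ γ) * ((m ^ 2) ^ γ)⁻¹ := by ring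
      _ ≤ _ := mul_le_mul_of_nonneg_left i1 hA
  · calc _ ≤ (r ^ ((N : ℝ) - 2 * s))⁻¹ * (bdist Ω x ^ γ * bdist Ω y ^ γ)
          * (2 ^ γ * ((m ^ 2) ^ γ)⁻¹) := mul_le_mul_of_nonneg_left i2 hA
      _ = _ := by ring

theorem weight_ne_zero (hΩ : IsBoundedC2Domain Ω) (hN : 0 < N) {x : Eucl N} (hx : x ∈ Ω) :
    weight Ω γ x ≠ 0 := by
  have := Real.rpow_pos_of_pos (hΩ.bdist_pos hN hx) γ
  simpa [weight] using this

theorem weight_ne_top (x : Eucl N) : weight Ω γ x ≠ ⊤ := ENNReal.ofReal_ne_top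

/-- Powers of the reduced kernel against powers of the weight are dominated by a power of the
distance. -/
theorem reducedKernel_rpow_mul_le (hγ : 0 < γ) {p : ℝ} (hp : 1 ≤ p) {x y : Eucl N} (hxy : x ≠ y) :
    reducedKernel Ω s γ x y ^ p * (weight Ω γ y ^ p * weight Ω γ y)
      ≤ ENNReal.ofReal (‖x - y‖ ^ (-(((N : ℝ) - 2 * s) * p + γ * (p - 1)))) := by
  have hr : 0 < ‖x - y‖ := norm_pos_iff.2 (sub_ne_zero.2 hxy)
  have hd := quasiDist_pos (Ω := Ω) (s := s) (γ := γ) hxy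
  have hδ := bdist_nonneg (Ω := Ω) y
  have hp0 : 0 ≤ p := by linarith
  have e : reducedKernel Ω s γ x y ^ p * (weight Ω γ y ^ p * weight Ω γ y)
      = ENNReal.ofReal (((quasiDist Ω s γ x y)⁻¹ * bdist Ω y ^ γ) ^ p * bdist Ω y ^ γ) := by
    unfold reducedKernel weight
    rw [← ENNReal.ofReal_inv_of_pos hd, ← mul_assoc, ← ENNReal.mul_rpow_of_nonneg _ _ hp0,
      ← ENNReal.ofReal_mul (by positivity), ENNReal.ofReal_rpow_of_nonneg (by positivity) hp0,
      ← ENNReal.ofReal_mul (by positivity)]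
  rw [e]
  refine ENNReal.ofReal_le_ofReal ?_
  set m := pairScale Ω x y with hm
  set r := ‖x - y‖
  have hrm : r ≤ m := norm_le_pairScale x y
  have hm0 : 0 < m := hr.trans_le hrm
  have hδm : bdist Ω y ^ γ ≤ m ^ γ :=
    Real.rpow_le_rpow hδ (bdist_right_le_pairScale x y) hγ.le
  have h1 : (quasiDist Ω s γ x y)⁻¹ * bdist Ω y ^ γ
      ≤ r ^ (-((N : ℝ) - 2 * s)) * m ^ (-γ) := by
    calc (quasiDist Ω s γ x y)⁻¹ * bdist Ω y ^ γ
        ≤ (quasiDist Ω s γ x y)⁻¹ * m ^ γ := by gcongr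
      _ = _ := by
        unfold quasiDist
        rw [← hm, mul_inv, ← Real.rpow_neg hr.le, ← Real.rpow_neg hm0.le, mul_assoc,
          ← Real.rpow_add hm0]
        congr 2; ring
  calc ((quasiDist Ω s γ x y)⁻¹ * bdist Ω y ^ γ) ^ p * bdist Ω y ^ γ
      ≤ (r ^ (-((N : ℝ) - 2 * s)) * m ^ (-γ)) ^ p * m ^ γ := by gcongr
    _ = r ^ (-((N : ℝ) - 2 * s) * p) * m ^ (-(γ * (p - 1))) := by
        rw [Real.mul_rpow (by positivity) (by positivity), ← Real.rpow_mul hr.le,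
          ← Real.rpow_mul hm0.le, mul_assoc, ← Real.rpow_add hm0]
        congr 2; ring
    _ ≤ r ^ (-((N : ℝ) - 2 * s) * p) * r ^ (-(γ * (p - 1))) := by
        gcongr ?_ * ?_
        exact Real.rpow_le_rpow_of_nonpos hr hrm
          (neg_nonpos.2 (mul_nonneg hγ.le (by linarith)))
    _ = _ := by
        rw [← Real.rpow_add hr]; congr 1; ring

theorem exists_lintegral_norm_rpow_le (hΩ : IsBoundedC2Domain Ω) (hN : 0 < N) {b : ℝ}
    (hb : b < N) :
    ∃ I : ℝ≥0∞, I ≠ ⊤ ∧ ∀ x ∈ Ω, ∫⁻ y in Ω, ENNReal.ofReal (‖x - y‖ ^ (-b)) ≤ I := by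
  obtain ⟨D, -, hD, -⟩ := hΩ.exists_diam_bound hN
  have hm : Measurable fun z : Eucl N => ‖z‖ ^ (-b) := measurable_norm.pow_const _
  have hi : IntegrableOn (fun z : Eucl N => ‖z‖ ^ (-b)) (Metric.ball 0 D) := by
    refine integrableOn_ball_of_norm_le_rpow (C := 1) (α := b) ?_ ?_ ?_ ?_
    · simpa using Nat.one_le_iff_ne_zero.2 hN.ne'
    · simpa using hb
    · refine Eventually.of_forall fun z => ?_
      rw [one_mul, Real.norm_of_nonneg (Real.rpow_nonneg (norm_nonneg _) _)]
    · exact hm.aestronglyMeasurable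
  refine ⟨∫⁻ z in Metric.ball (0 : Eucl N) D, ENNReal.ofReal (‖z‖ ^ (-b)), ?_, fun x hx => ?_⟩
  · exact hi.lintegral_lt_top.ne
  · rw [← lintegral_indicator hΩ.isOpen.measurableSet,
      ← lintegral_indicator Metric.isOpen_ball.measurableSet]
    refine le_trans (lintegral_mono fun y => ?_) (lintegral_sub_left_eq_self _ x).le
    by_cases hy : y ∈ Ω
    · have : x - y ∈ Metric.ball (0 : Eucl N) D := by
        rw [mem_ball_zero_iff]; exact hD x hx y hy
      rw [Set.indicator_of_mem hy, Set.indicator_of_mem this]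
    · rw [Set.indicator_of_notMem hy]; exact zero_le

/-- The case `p = 1` bounds the Green operator on the weight; for `p > 1` the condition on the
exponents says that `p` is subcritical. -/
theorem exists_lintegral_reducedKernel_le (hΩ : IsBoundedC2Domain Ω) (hN : 0 < N) (hγ : 0 < γ)
    {p : ℝ} (hp : 1 ≤ p) (hb : ((N : ℝ) - 2 * s) * p + γ * (p - 1) < N) :
    ∃ I : ℝ≥0∞, I ≠ ⊤ ∧ ∀ x ∈ Ω,
      ∫⁻ y in Ω, reducedKernel Ω s γ x y ^ p * (weight Ω γ y ^ p * weight Ω γ y) ≤ I := by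
  have : Nonempty (Fin N) := ⟨⟨0, hN⟩⟩
  obtain ⟨I, hI, h⟩ := exists_lintegral_norm_rpow_le hΩ hN hb
  refine ⟨I, hI, fun x hx => le_trans (lintegral_mono_ae ?_) (h x hx)⟩
  refine ae_restrict_of_ae ?_
  filter_upwards [compl_mem_ae_iff.2 (measure_singleton (μ := (volume : Measure (Eucl N))) x)]
    with y hy
  exact reducedKernel_rpow_mul_le hγ hp (fun h => hy h.symm)

end Kernel

/-! ### The Green function as a weighted kernel -/

section Kernel
variable {N : ℕ} {Ω : Set (Eucl N)} {s γ : ℝ}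

open Classical in
/-- The Green function as an extended nonnegative kernel on the whole space. Off the diagonal of
`Ω × Ω` it is `G`; elsewhere it is `δ(x)^γ δ(y)^γ` times the reduced kernel, which makes it infinite
on the diagonal of `Ω × Ω` and lets the two-sided estimate hold there as well. -/
noncomputable def greenKernel (Ω : Set (Eucl N)) (s γ : ℝ) (G : Eucl N → Eucl N → ℝ)
    (x y : Eucl N) : ℝ≥0∞ :=
  if x ∈ Ω ∧ y ∈ Ω ∧ x ≠ y then ENNReal.ofReal (G x y)
  else weight Ω γ x * weight Ω γ y * reducedKernel Ω s γ x y

theorem greenKernel_of_ne {G : Eucl N → Eucl N → ℝ} {x y : Eucl N} (hx : x ∈ Ω) (hy : y ∈ Ω)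
    (hxy : x ≠ y) : greenKernel Ω s γ G x y = ENNReal.ofReal (G x y) :=
  if_pos ⟨hx, hy, hxy⟩

variable {L : (Eucl N → ℝ) →ₗ.[ℝ] (Ω → ℝ)} {G : Eucl N → Eucl N → ℝ}

theorem measurable_greenKernel (hΩ : IsBoundedC2Domain Ω) (hγ : 0 < γ)
    (hG : IsGreenFunction Ω s γ L G) :
    Measurable (Function.uncurry (greenKernel Ω s γ G)) := by
  classical
  set T : Set (Eucl N × Eucl N) := {z | z.1 ∈ Ω ∧ z.2 ∈ Ω ∧ z.1 ≠ z.2} with hT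
  have hTm : MeasurableSet T := by
    have h1 : MeasurableSet {z : Eucl N × Eucl N | z.1 ∈ Ω} :=
      measurable_fst hΩ.isOpen.measurableSet
    have h2 : MeasurableSet {z : Eucl N × Eucl N | z.2 ∈ Ω} :=
      measurable_snd hΩ.isOpen.measurableSet
    have h3 : MeasurableSet {z : Eucl N × Eucl N | z.1 ≠ z.2} :=
      (measurableSet_eq_fun measurable_fst measurable_snd).compl
    exact h1.inter (h2.inter h3)
  have hw := measurable_weight (Ω := Ω) hγ.le
  refine measurable_of_restrict_of_restrict_compl hTm ?_ ?_
  · have : T.domRestrict (Function.uncurry (greenKernel Ω s γ G))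
        = fun z => ENNReal.ofReal (T.domRestrict (fun z => G z.1 z.2) z) := by
      ext ⟨z, hz⟩
      exact if_pos hz
    rw [this]
    exact hG.measurable.ennreal_ofReal
  · have : Tᶜ.domRestrict (Function.uncurry (greenKernel Ω s γ G))
        = Tᶜ.domRestrict (fun z : Eucl N × Eucl N =>
          weight Ω γ z.1 * weight Ω γ z.2 * reducedKernel Ω s γ z.1 z.2) := by
      ext ⟨z, hz⟩
      exact if_neg hz
    rw [this]
    exact ((((hw.comp measurable_fst).mul (hw.comp measurable_snd)).mul
      measurable_reducedKernel)).comp measurable_subtype_coe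

theorem greenKernel_comm (hG : IsGreenFunction Ω s γ L G) (x y : Eucl N) :
    greenKernel Ω s γ G x y = greenKernel Ω s γ G y x := by
  by_cases h : x ∈ Ω ∧ y ∈ Ω ∧ x ≠ y
  · rw [greenKernel_of_ne h.1 h.2.1 h.2.2, greenKernel_of_ne h.2.1 h.1 h.2.2.symm,
      hG.symm x h.1 y h.2.1 h.2.2]
  · have h' : ¬ (y ∈ Ω ∧ x ∈ Ω ∧ y ≠ x) := fun h2 => h ⟨h2.2.1, h2.1, h2.2.2.symm⟩
    rw [greenKernel, if_neg h, greenKernel, if_neg h', mul_comm (weight Ω γ x), reducedKernel_comm]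

theorem greenKernel_bounds (hΩ : IsBoundedC2Domain Ω) (hN : 0 < N) (hγ : 0 < γ)
    (hG : IsGreenFunction Ω s γ L G) :
    ∃ a A : ℝ≥0∞, a ≠ 0 ∧ a ≠ ⊤ ∧ A ≠ ⊤ ∧ ∀ x ∈ Ω, ∀ y ∈ Ω,
      a * (weight Ω γ x * weight Ω γ y * reducedKernel Ω s γ x y) ≤ greenKernel Ω s γ G x y ∧
      greenKernel Ω s γ G x y ≤ A * (weight Ω γ x * weight Ω γ y * reducedKernel Ω s γ x y) := by
  obtain ⟨c, C, hc, hC, h⟩ := hG.two_sided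
  refine ⟨ENNReal.ofReal (min c 1), ENNReal.ofReal (max (C * 2 ^ γ) 1), by simpa using hc,
    ENNReal.ofReal_ne_top, ENNReal.ofReal_ne_top, fun x hx y hy => ?_⟩
  by_cases hxy : x = y
  · have hn : ¬ (x ∈ Ω ∧ y ∈ Ω ∧ x ≠ y) := fun h2 => h2.2.2 hxy
    rw [greenKernel, if_neg hn]
    constructor
    · refine mul_le_of_le_one_left' ?_
      rw [← ENNReal.ofReal_one]
      exact ENNReal.ofReal_le_ofReal (min_le_right _ _)
    · refine le_mul_of_one_le_left' ?_
      rw [← ENNReal.ofReal_one]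
      exact ENNReal.ofReal_le_ofReal (le_max_right _ _)
  · rw [greenKernel_of_ne hx hy hxy]
    have hd := quasiDist_pos (Ω := Ω) (s := s) (γ := γ) hxy
    have e : weight Ω γ x * weight Ω γ y * reducedKernel Ω s γ x y
        = ENNReal.ofReal (bdist Ω x ^ γ * bdist Ω y ^ γ * (quasiDist Ω s γ x y)⁻¹) := by
      have h1 := bdist_nonneg (Ω := Ω) x
      have h2 := bdist_nonneg (Ω := Ω) y
      rw [weight, weight, reducedKernel, ← ENNReal.ofReal_inv_of_pos hd,
        ← ENNReal.ofReal_mul (by positivity), ← ENNReal.ofReal_mul (by positivity)]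
    obtain ⟨b1, b2⟩ := modelKernel_bounds (s := s) hγ (hΩ.bdist_pos hN hx)
      (hΩ.bdist_pos hN hy) hxy
    obtain ⟨b3, b4⟩ := h x hx y hy hxy
    set X := bdist Ω x ^ γ * bdist Ω y ^ γ * (quasiDist Ω s γ x y)⁻¹
    have hX : 0 ≤ X := by
      have h1 := bdist_nonneg (Ω := Ω) x
      have h2 := bdist_nonneg (Ω := Ω) y
      positivity
    rw [e, ← ENNReal.ofReal_mul (by positivity), ← ENNReal.ofReal_mul (by positivity)]
    constructor
    · refine ENNReal.ofReal_le_ofReal (le_trans ?_ b3)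
      exact mul_le_mul (min_le_left _ _) b1 hX hc.le
    · refine ENNReal.ofReal_le_ofReal (b4.trans ?_)
      calc C * modelKernel Ω s γ x y ≤ C * (2 ^ γ * X) := by gcongr
        _ = C * 2 ^ γ * X := by ring
        _ ≤ _ := by gcongr; exact le_max_left _ _

theorem exists_le_reducedKernel (hΩ : IsBoundedC2Domain Ω) (hN : 2 * s < N) (hN0 : 0 < N)
    (hγ : 0 < γ) :
    ∃ b : ℝ≥0∞, b ≠ 0 ∧ b ≠ ⊤ ∧ ∀ x ∈ Ω, ∀ y ∈ Ω, b ≤ reducedKernel Ω s γ x y := by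
  obtain ⟨D, hD0, hD, hδ⟩ := hΩ.exists_diam_bound hN0
  have hpos : 0 < D ^ ((N : ℝ) - 2 * s) * D ^ (2 * γ) := by positivity
  refine ⟨(ENNReal.ofReal (D ^ ((N : ℝ) - 2 * s) * D ^ (2 * γ)))⁻¹, ?_, ?_, fun x hx y hy => ?_⟩
  · exact ENNReal.inv_ne_zero.2 ENNReal.ofReal_ne_top
  · exact ENNReal.inv_ne_top.2 (by simpa using hpos)
  · refine ENNReal.inv_le_inv.2 (ENNReal.ofReal_le_ofReal ?_)
    have h1 : pairScale Ω x y ≤ D := max_le (hD x hx y hy).le (max_le (hδ x hx) (hδ y hy))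
    exact mul_le_mul (Real.rpow_le_rpow (norm_nonneg _) (hD x hx y hy).le (by linarith))
      (Real.rpow_le_rpow (pairScale_nonneg _ _) h1 (by linarith))
      (Real.rpow_nonneg (pairScale_nonneg _ _) _) (by positivity)

theorem ae_mem_domain (hΩ : IsBoundedC2Domain Ω) : ∀ᵐ x ∂(volume.restrict Ω), x ∈ Ω :=
  ae_restrict_mem hΩ.isOpen.measurableSet

theorem exists_isWeightedKernel (hΩ : IsBoundedC2Domain Ω) (hs : 0 < s) (hγ : 0 < γ)
    (hN : 2 * s < N) (hG : IsGreenFunction Ω s γ L G) :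
    ∃ c C : ℝ≥0∞, IsWeightedKernel (volume.restrict Ω) Ω (greenKernel Ω s γ G) (weight Ω γ) c C := by
  have hN0 : 0 < N := by
    have : (0 : ℝ) < N := by linarith
    exact_mod_cast this
  obtain ⟨a, A, ha, hat, hAt, hk⟩ := greenKernel_bounds hΩ hN0 hγ hG
  obtain ⟨b, hb, hbt, hbk⟩ := exists_le_reducedKernel (γ := γ) hΩ hN hN0 hγ
  obtain ⟨I, hI, hIk⟩ := exists_lintegral_reducedKernel_le (s := s) (p := 1) hΩ hN0 hγ le_rfl
    (by linarith)
  obtain ⟨D, hD0, hD, hδ⟩ := hΩ.exists_diam_bound hN0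
  refine ⟨a * b, A * I + ENNReal.ofReal (D ^ γ), ?_⟩
  constructor
  · exact measurable_greenKernel hΩ hγ hG
  · exact measurable_weight hγ.le
  · exact greenKernel_comm hG
  · exact ae_mem_domain hΩ
  · rw [Ne, Measure.restrict_eq_zero]
    exact (hΩ.isOpen.measure_pos _ hΩ.isConnected.nonempty).ne'
  · rw [Measure.restrict_apply_univ]
    exact hΩ.isBounded.measure_lt_top.ne
  · exact mul_ne_zero ha hb
  · exact ENNReal.mul_ne_top hat hbt
  · exact ENNReal.add_ne_top.2 ⟨ENNReal.mul_ne_top hAt hI, ENNReal.ofReal_ne_top⟩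
  · exact fun x hx => weight_ne_zero hΩ hN0 hx
  · refine fun x hx => le_add_left (ENNReal.ofReal_le_ofReal ?_)
    exact Real.rpow_le_rpow (bdist_nonneg x) (hδ x hx) hγ.le
  · intro x hx y hy
    refine le_trans ?_ (hk x hx y hy).1
    calc a * b * (weight Ω γ x * weight Ω γ y) = a * (weight Ω γ x * weight Ω γ y * b) := by ring
      _ ≤ _ := by gcongr; exact hbk x hx y hy
  · intro x hx
    have hm : Measurable fun y => reducedKernel Ω s γ x y ^ (1 : ℝ)
        * (weight Ω γ y ^ (1 : ℝ) * weight Ω γ y) :=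
      ((measurable_reducedKernel.comp measurable_prodMk_left).pow_const _).mul
        (((measurable_weight hγ.le).pow_const _).mul (measurable_weight hγ.le))
    calc ∫⁻ y in Ω, greenKernel Ω s γ G x y * weight Ω γ y
        ≤ ∫⁻ y in Ω, A * weight Ω γ x * (reducedKernel Ω s γ x y ^ (1 : ℝ)
          * (weight Ω γ y ^ (1 : ℝ) * weight Ω γ y)) := by
          refine lintegral_mono_ae ?_
          filter_upwards [ae_mem_domain hΩ] with y hy
          rw [ENNReal.rpow_one, ENNReal.rpow_one]
          calc _ ≤ A * (weight Ω γ x * weight Ω γ y * reducedKernel Ω s γ x y) * weight Ω γ y := by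
                gcongr; exact (hk x hx y hy).2
            _ = _ := by ring
      _ = A * weight Ω γ x * ∫⁻ y in Ω, reducedKernel Ω s γ x y ^ (1 : ℝ)
          * (weight Ω γ y ^ (1 : ℝ) * weight Ω γ y) := lintegral_const_mul _ hm
      _ ≤ A * weight Ω γ x * I := by gcongr; exact hIk x hx
      _ = A * I * weight Ω γ x := by ring
      _ ≤ _ := by gcongr; exact le_self_add

theorem mul_rpow_le_of_mul_le {a b h k : ℝ≥0∞} {p : ℝ} (hp : 1 ≤ p)
    (hab : a * b ≤ k * h * (a + b)) : a * b ^ p ≤ 2 * k * h * (a ^ p + b ^ p) := by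
  have split : ∀ t : ℝ≥0∞, t ^ p = t * t ^ (p - 1) := fun t => by
    conv_lhs => rw [show p = 1 + (p - 1) by ring,
      ENNReal.rpow_add_of_nonneg _ _ zero_le_one (by linarith), ENNReal.rpow_one]
  have key : (a + b) * b ^ (p - 1) ≤ 2 * (a ^ p + b ^ p) := by
    calc (a + b) * b ^ (p - 1) ≤ (max a b + max a b) * max a b ^ (p - 1) := by
          gcongr
          · exact le_max_left _ _
          · exact le_max_right _ _
          · exact le_max_right _ _
      _ = 2 * max a b ^ p := by rw [split, ← two_mul, mul_assoc]
      _ ≤ 2 * (a ^ p + b ^ p) := by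
          gcongr
          rcases le_total a b with h | h
          · rw [max_eq_right h]; exact le_add_self
          · rw [max_eq_left h]; exact le_self_add
  calc a * b ^ p = a * b * b ^ (p - 1) := by rw [split]; ring
    _ ≤ k * h * (a + b) * b ^ (p - 1) := by gcongr
    _ = k * h * ((a + b) * b ^ (p - 1)) := by ring
    _ ≤ k * h * (2 * (a ^ p + b ^ p)) := by gcongr
    _ = _ := by ring

theorem exists_isSubcritical (hΩ : IsBoundedC2Domain Ω) (hs : 0 < s) (hγ : 0 < γ)
    (hN : 2 * s < N) (hG : IsGreenFunction Ω s γ L G) {p : ℝ} (hp : 1 < p)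
    (hpc : p < criticalExponent N s γ) :
    ∃ K : ℝ≥0∞, IsSubcritical (volume.restrict Ω) Ω (greenKernel Ω s γ G) (weight Ω γ) p K := by
  have hN0 : 0 < N := by
    have : (0 : ℝ) < N := by linarith
    exact_mod_cast this
  have hp0 : 0 < p := by linarith
  have hb : ((N : ℝ) - 2 * s) * p + γ * (p - 1) < N := by
    rw [criticalExponent, lt_div_iff₀ (by linarith)] at hpc
    linarith
  obtain ⟨a, A, ha, hat, hAt, hk⟩ := greenKernel_bounds hΩ hN0 hγ hG
  obtain ⟨I, hI, hIk⟩ := exists_lintegral_reducedKernel_le (s := s) (p := p) hΩ hN0 hγ hp.le hb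
  set κ := ENNReal.ofReal (2 ^ ((N : ℝ) - 2 * s + 2 * γ)) with hκ
  have hm : ∀ x, Measurable fun y => reducedKernel Ω s γ x y ^ p
        * (weight Ω γ y ^ p * weight Ω γ y) := fun x =>
      ((measurable_reducedKernel.comp measurable_prodMk_left).pow_const _).mul
        (((measurable_weight hγ.le).pow_const _).mul (measurable_weight hγ.le))
  have hquot : ∀ y ∈ Ω, ∀ z ∈ Ω, greenKernel Ω s γ G y z / weight Ω γ z
      ≤ A * (weight Ω γ y * reducedKernel Ω s γ z y) := by
    intro y hy z hz
    rw [ENNReal.div_le_iff (weight_ne_zero hΩ hN0 hz) (weight_ne_top z)]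
    refine (hk y hy z hz).2.trans (le_of_eq ?_)
    rw [reducedKernel_comm]; ring
  refine ⟨A * A ^ p * (2 * κ) * (2 * I) * a⁻¹ + A ^ p * I, ?_, ?_, ?_⟩
  · have hAp : A ^ p ≠ ⊤ := ENNReal.rpow_ne_top_of_nonneg hp0.le hAt
    have h2 : (2 : ℝ≥0∞) ≠ ⊤ := by simp
    have hκt : κ ≠ ⊤ := ENNReal.ofReal_ne_top
    refine ENNReal.add_ne_top.2 ⟨?_, ENNReal.mul_ne_top hAp hI⟩
    exact ENNReal.mul_ne_top (ENNReal.mul_ne_top (ENNReal.mul_ne_top (ENNReal.mul_ne_top hAt hAp)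
      (ENNReal.mul_ne_top h2 hκt)) (ENNReal.mul_ne_top h2 hI)) (ENNReal.inv_ne_top.2 ha)
  · intro x hx z hz
    set H := reducedKernel Ω s γ with hH
    set w := weight Ω γ with hw
    calc ∫⁻ y in Ω, greenKernel Ω s γ G x y * (greenKernel Ω s γ G y z / w z) ^ p
        ≤ ∫⁻ y in Ω, A * A ^ p * (2 * κ) * (w x * H x z)
          * (H x y ^ p * (w y ^ p * w y) + H z y ^ p * (w y ^ p * w y)) := by
          refine lintegral_mono_ae ?_
          filter_upwards [ae_mem_domain hΩ] with y hy
          calc greenKernel Ω s γ G x y * (greenKernel Ω s γ G y z / w z) ^ p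
              ≤ A * (w x * w y * H x y) * (A * (w y * H z y)) ^ p := by
                gcongr
                · exact (hk x hx y hy).2
                · exact hquot y hy z hz
            _ = A * A ^ p * w x * (w y ^ p * w y) * (H x y * H z y ^ p) := by
                rw [ENNReal.mul_rpow_of_nonneg _ _ hp0.le, ENNReal.mul_rpow_of_nonneg _ _ hp0.le]
                ring
            _ ≤ A * A ^ p * w x * (w y ^ p * w y)
                * (2 * κ * H x z * (H x y ^ p + H z y ^ p)) := by
                refine mul_le_mul' le_rfl (mul_rpow_le_of_mul_le hp.le ?_)
                have := reducedKernel_mul_le (Ω := Ω) hN hγ x y z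
                rwa [reducedKernel_comm y z] at this
            _ = _ := by ring
      _ = A * A ^ p * (2 * κ) * (w x * H x z) * ((∫⁻ y in Ω, H x y ^ p * (w y ^ p * w y))
          + ∫⁻ y in Ω, H z y ^ p * (w y ^ p * w y)) := by
          rw [lintegral_const_mul _ (show Measurable fun y => H x y ^ p * (w y ^ p * w y)
            + H z y ^ p * (w y ^ p * w y) from (hm x).add (hm z)), lintegral_add_left (hm x)]
      _ ≤ A * A ^ p * (2 * κ) * (w x * H x z) * (I + I) := by
          gcongr
          · exact hIk x hx
          · exact hIk z hz
      _ ≤ A * A ^ p * (2 * κ) * (a⁻¹ * (greenKernel Ω s γ G x z / w z)) * (I + I) := by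
          refine mul_le_mul' (mul_le_mul' le_rfl ?_) le_rfl
          rw [← mul_div_assoc, ENNReal.le_div_iff_mul_le (Or.inl (weight_ne_zero hΩ hN0 hz))
            (Or.inl (weight_ne_top z))]
          calc w x * H x z * w z = a⁻¹ * (a * (w x * w z * H x z)) := by
                rw [← mul_assoc a⁻¹, ENNReal.inv_mul_cancel ha hat]; ring
            _ ≤ _ := by gcongr; exact (hk x hx z hz).1
      _ = A * A ^ p * (2 * κ) * (2 * I) * a⁻¹ * (greenKernel Ω s γ G x z / w z) := by ring
      _ ≤ _ := by gcongr; exact le_self_add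
  · intro z hz
    calc ∫⁻ y in Ω, (greenKernel Ω s γ G y z / weight Ω γ z) ^ p * weight Ω γ y
        ≤ ∫⁻ y in Ω, A ^ p * (reducedKernel Ω s γ z y ^ p
          * (weight Ω γ y ^ p * weight Ω γ y)) := by
          refine lintegral_mono_ae ?_
          filter_upwards [ae_mem_domain hΩ] with y hy
          calc _ ≤ (A * (weight Ω γ y * reducedKernel Ω s γ z y)) ^ p * weight Ω γ y := by
                gcongr; exact hquot y hy z hz
            _ = _ := by
                rw [ENNReal.mul_rpow_of_nonneg _ _ hp0.le, ENNReal.mul_rpow_of_nonneg _ _ hp0.le]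
                ring
      _ = A ^ p * ∫⁻ y in Ω, reducedKernel Ω s γ z y ^ p
          * (weight Ω γ y ^ p * weight Ω γ y) := lintegral_const_mul _ (hm z)
      _ ≤ A ^ p * I := by gcongr; exact hIk z hz
      _ ≤ _ := le_add_self

end Kernel

/-! ### Weak-dual solutions and the integral equation -/

section Duality
variable {N : ℕ} {Ω : Set (Eucl N)} {s γ : ℝ}
variable {L : (Eucl N → ℝ) →ₗ.[ℝ] (Ω → ℝ)} {G : Eucl N → Eucl N → ℝ} {c C : ℝ≥0∞}

theorem ae_ne_of_volume (hN : 0 < N) (x : Eucl N) :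
    ∀ᵐ y ∂(volume : Measure (Eucl N)), y ≠ x := by
  have : Nonempty (Fin N) := ⟨⟨0, hN⟩⟩
  exact compl_mem_ae_iff.2 (measure_singleton x)

theorem greenKernel_toReal (hG : IsGreenFunction Ω s γ L G) {x y : Eucl N} (hx : x ∈ Ω)
    (hy : y ∈ Ω) (hxy : x ≠ y) : (greenKernel Ω s γ G x y).toReal = G x y := by
  rw [greenKernel_of_ne hx hy hxy, ENNReal.toReal_ofReal (hG.pos x hx y hy hxy).le]

theorem greenKernel_self (hΩ : IsBoundedC2Domain Ω) (hN : 2 * s < N) (hN0 : 0 < N)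
    {x : Eucl N} (hx : x ∈ Ω) : greenKernel Ω s γ G x x = ⊤ := by
  have hn : ¬ (x ∈ Ω ∧ x ∈ Ω ∧ x ≠ x) := fun h => h.2.2 rfl
  have hw := weight_ne_zero (γ := γ) hΩ hN0 hx
  rw [greenKernel, if_neg hn, reducedKernel, quasiDist_self hN, ENNReal.ofReal_zero,
    ENNReal.inv_zero, ENNReal.mul_top (mul_ne_zero hw hw)]

theorem IsWeightedKernel.ae_potential_lt_top {E : Type*} [MeasurableSpace E] {ν θ : Measure E}
    {S : Set E} {g : E → E → ℝ≥0∞} {w : E → ℝ≥0∞} [SFinite ν] [SFinite θ]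
    (h : IsWeightedKernel ν S g w c C) (hθ : ∀ᵐ x ∂θ, x ∈ S) (hθw : ∫⁻ x, w x ∂θ ≠ ⊤) :
    ∀ᵐ x ∂ν, potential g θ x < ⊤ := by
  have h1 : ∫⁻ x, potential g θ x * w x ∂ν ≠ ⊤ :=
    ne_top_of_le_ne_top (ENNReal.mul_ne_top h.upper_ne_top hθw)
      (h.lintegral_potential_mul_weight_le hθ)
  filter_upwards [ae_lt_top ((h.measurable_potential θ).mul h.measurable_weight) h1, h.ae_mem]
    with x hx hS
  exact lt_top_iff_ne_top.2 fun ht => by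
    simp [ht, ENNReal.top_mul (h.weight_ne_zero x hS)] at hx

/-- Fubini's theorem for the Green operator tested against `δ^γ L^∞`. -/
theorem integral_greenFun (hN0 : 0 < N) (hG : IsGreenFunction Ω s γ L G)
    (h : IsWeightedKernel (volume.restrict Ω) Ω (greenKernel Ω s γ G) (weight Ω γ) c C)
    {θ : Measure (Eucl N)} [SFinite θ] (hθ : ∀ᵐ x ∂θ, x ∈ Ω) (hθw : ∫⁻ x, weight Ω γ x ∂θ ≠ ⊤)
    {ξ : Eucl N → ℝ} (hξ : ξ ∈ weightedLinfty Ω γ) :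
    Integrable (fun y => (potential (greenKernel Ω s γ G) θ y).toReal * ξ y) (volume.restrict Ω) ∧
    ∫ x, greenFun Ω G ξ x ∂θ
      = ∫ y in Ω, (potential (greenKernel Ω s γ G) θ y).toReal * ξ y := by
  obtain ⟨v, hv, hξv⟩ := hξ
  set ν : Measure (Eucl N) := volume.restrict Ω with hν
  set g := greenKernel Ω s γ G with hg
  have hgm : Measurable fun q : Eucl N × Eucl N => g q.1 q.2 := h.measurable_kernel
  have hbm : Measurable fun y => bdist Ω y ^ γ := continuous_bdist.measurable.pow_const _
  have hξm : AEStronglyMeasurable ξ ν := by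
    refine (hbm.aestronglyMeasurable.mul hv.aestronglyMeasurable).congr ?_
    filter_upwards [h.ae_mem] with y hy using (hξv y hy).symm
  set M := eLpNorm v ⊤ ν with hM
  have hξb : ∀ᵐ y ∂ν, ‖ξ y‖ₑ ≤ M * weight Ω γ y := by
    have h1 : ∀ᵐ y ∂ν, ‖v y‖ₑ ≤ M := by
      rw [hM, eLpNorm_exponent_top]; exact ae_le_eLpNormEssSup
    filter_upwards [h1, h.ae_mem] with y hy hyS
    rw [hξv y hyS, enorm_mul, mul_comm,
      Real.enorm_of_nonneg (Real.rpow_nonneg (bdist_nonneg _) _)]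
    exact mul_le_mul' hy le_rfl
  have hFm : AEStronglyMeasurable (fun q : Eucl N × Eucl N => (g q.1 q.2).toReal * ξ q.2)
      (θ.prod ν) :=
    hgm.ennreal_toReal.aestronglyMeasurable.mul hξm.comp_snd
  have hFi : Integrable (fun q : Eucl N × Eucl N => (g q.1 q.2).toReal * ξ q.2) (θ.prod ν) := by
    refine ⟨hFm, ?_⟩
    rw [HasFiniteIntegral, lintegral_prod _ hFm.enorm]
    calc ∫⁻ x, ∫⁻ y, ‖(g x y).toReal * ξ y‖ₑ ∂ν ∂θ
        ≤ ∫⁻ x, M * (C * weight Ω γ x) ∂θ := by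
          refine lintegral_mono_ae ?_
          filter_upwards [hθ] with x hx
          calc ∫⁻ y, ‖(g x y).toReal * ξ y‖ₑ ∂ν ≤ ∫⁻ y, M * (g x y * weight Ω γ y) ∂ν := by
                refine lintegral_mono_ae ?_
                filter_upwards [hξb] with y hy
                rw [enorm_mul, Real.enorm_of_nonneg ENNReal.toReal_nonneg]
                calc _ ≤ g x y * (M * weight Ω γ y) := mul_le_mul' ENNReal.ofReal_toReal_le hy
                  _ = _ := by ring
            _ = M * ∫⁻ y, g x y * weight Ω γ y ∂ν :=
                lintegral_const_mul _ ((h.measurable_section x).mul h.measurable_weight)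
            _ ≤ _ := by gcongr; exact h.lintegral_le x hx
      _ = M * (C * ∫⁻ x, weight Ω γ x ∂θ) := by
          rw [lintegral_const_mul _ (h.measurable_weight.const_mul _),
            lintegral_const_mul _ h.measurable_weight]
      _ < ⊤ := ENNReal.mul_lt_top hv.eLpNorm_lt_top
          (ENNReal.mul_lt_top h.upper_ne_top.lt_top hθw.lt_top)
  have hinner : ∀ᵐ y ∂ν, ∫ x, (g x y).toReal * ξ y ∂θ = (potential g θ y).toReal * ξ y := by
    filter_upwards [h.ae_potential_lt_top hθ hθw] with y hy
    rw [integral_mul_const]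
    congr 1
    have e : potential g θ y = ∫⁻ x, g x y ∂θ := lintegral_congr fun x => h.symm y x
    have hm : Measurable fun x => g x y := h.measurable_section' y
    rw [e] at hy ⊢
    exact integral_toReal hm.aemeasurable (ae_lt_top hm hy.ne)
  refine ⟨hFi.integral_prod_right.congr hinner, ?_⟩
  have hleft : ∫ x, greenFun Ω G ξ x ∂θ = ∫ x, ∫ y, (g x y).toReal * ξ y ∂ν ∂θ := by
    refine integral_congr_ae ?_
    filter_upwards [hθ] with x hx
    refine integral_congr_ae ?_
    filter_upwards [h.ae_mem, ae_restrict_of_ae (ae_ne_of_volume hN0 x)] with y hy hyx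
    rw [greenKernel_toReal hG hx hy hyx.symm]
  rw [hleft, integral_integral_swap hFi]
  exact integral_congr_ae hinner

theorem IsWeightedRadon.ae_mem {μ : Measure (Eucl N)} (hμ : IsWeightedRadon Ω γ μ) :
    ∀ᵐ x ∂μ, x ∈ Ω :=
  mem_ae_iff.2 hμ.carried

theorem IsWeightedRadon.weightedNorm_eq {μ : Measure (Eucl N)} (hμ : IsWeightedRadon Ω γ μ) :
    weightedNorm Ω γ μ = ∫⁻ x, weight Ω γ x ∂μ := by
  unfold weightedNorm
  rw [Measure.restrict_eq_self_of_ae_mem hμ.ae_mem]; rfl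

theorem IsWeightedRadon.sFinite {μ : Measure (Eucl N)} (hμ : IsWeightedRadon Ω γ μ)
    (hΩ : IsBoundedC2Domain Ω) (hN0 : 0 < N) (hγ : 0 < γ) : SFinite μ := by
  have hfin : IsFiniteMeasure (μ.withDensity (weight Ω γ)) := by
    refine isFiniteMeasure_withDensity ?_
    rw [← hμ.weightedNorm_eq]; exact hμ.finite_norm.ne
  refine sFinite_of_absolutelyContinuous
    (withDensity_absolutelyContinuous' (measurable_weight (Ω := Ω) hγ.le).aemeasurable ?_)
  filter_upwards [hμ.ae_mem] with x hx using weight_ne_zero hΩ hN0 hx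

/-- The point left out in `greenMeas` does not matter almost everywhere: the kernel is infinite on
the diagonal, so the potential is infinite at the atoms of `μ`. -/
theorem ae_greenMeas_eq (hΩ : IsBoundedC2Domain Ω) (hN : 2 * s < N) (hN0 : 0 < N)
    (hG : IsGreenFunction Ω s γ L G)
    (h : IsWeightedKernel (volume.restrict Ω) Ω (greenKernel Ω s γ G) (weight Ω γ) c C)
    {μ : Measure (Eucl N)} [SFinite μ] (hμ : IsWeightedRadon Ω γ μ) :
    ∀ᵐ x ∂(volume.restrict Ω), potential (greenKernel Ω s γ G) μ x < ⊤ ∧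
      greenMeas Ω G μ x = (potential (greenKernel Ω s γ G) μ x).toReal := by
  have hw : ∫⁻ x, weight Ω γ x ∂μ ≠ ⊤ := by
    rw [← hμ.weightedNorm_eq]; exact hμ.finite_norm.ne
  filter_upwards [h.ae_potential_lt_top hμ.ae_mem hw, h.ae_mem] with x hx hxS
  refine ⟨hx, ?_⟩
  have hlt := ae_lt_top (h.measurable_section x) hx.ne
  -- a point where the potential is finite is not an atom
  have hmem : ∀ᵐ y ∂μ, y ∈ Ω \ {x} := by
    filter_upwards [hlt, hμ.ae_mem] with y hy hyS
    refine ⟨hyS, fun hyx => ?_⟩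
    rw [Set.mem_singleton_iff.1 hyx, greenKernel_self hΩ hN hN0 hxS] at hy
    exact lt_irrefl _ hy
  unfold greenMeas potential
  rw [Measure.restrict_eq_self_of_ae_mem hmem,
    ← integral_toReal (h.measurable_section x).aemeasurable hlt]
  refine integral_congr_ae ?_
  filter_upwards [hmem] with y hy
  rw [greenKernel_toReal hG hxS hy.1 (fun e => hy.2 e.symm)]

theorem aemeasurable_of_memLp (hΩ : IsBoundedC2Domain Ω) (hN0 : 0 < N) (hγ : 0 < γ) {q : ℝ≥0∞}
    {u : Eucl N → ℝ} (hu : MemLp u q (weightedVolume Ω γ)) :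
    AEMeasurable u (volume.restrict Ω) := by
  refine hu.aestronglyMeasurable.aemeasurable.mono_ac
    (withDensity_absolutelyContinuous' (measurable_weight hγ.le).aemeasurable ?_)
  filter_upwards [ae_mem_domain hΩ] with x hx using weight_ne_zero hΩ hN0 hx

theorem memLp_weightedVolume_iff (hγ : 0 < γ) {p : ℝ} (hp : 1 < p) {u : Eucl N → ℝ}
    (hu : AEMeasurable u (volume.restrict Ω)) (hu0 : ∀ᵐ x ∂(volume.restrict Ω), 0 ≤ u x) :
    MemLp u (ENNReal.ofReal p) (weightedVolume Ω γ) ↔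
      ∫⁻ x in Ω, ENNReal.ofReal (u x) ^ p * weight Ω γ x ≠ ⊤ := by
  have hp0 : 0 < p := by linarith
  have hm : AEStronglyMeasurable u (weightedVolume Ω γ) :=
    (hu.mono_ac (withDensity_absolutelyContinuous _ _)).aestronglyMeasurable
  have e : ∫⁻ x, ‖u x‖ₑ ^ p ∂(weightedVolume Ω γ)
      = ∫⁻ x in Ω, ENNReal.ofReal (u x) ^ p * weight Ω γ x := by
    change ∫⁻ x, ‖u x‖ₑ ^ p ∂((volume.restrict Ω).withDensity (weight Ω γ)) = _
    rw [lintegral_withDensity_eq_lintegral_mul₀ (measurable_weight hγ.le).aemeasurable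
      (hu.enorm.pow_const p)]
    refine lintegral_congr_ae ?_
    filter_upwards [hu0] with x hx
    simp only [Pi.mul_apply]
    rw [Real.enorm_of_nonneg hx, mul_comm]
  have h1 := eLpNorm_lt_top_iff_lintegral_rpow_enorm_lt_top (f := u) (μ := weightedVolume Ω γ)
    (p := ENNReal.ofReal p) (by simpa using hp0) ENNReal.ofReal_ne_top
  rw [ENNReal.toReal_ofReal hp0.le, e] at h1
  rw [← lt_top_iff_ne_top, ← h1]
  exact ⟨fun hh => hh.2, fun hh => ⟨hm, hh⟩⟩

/-- The measure `u^p dx` on `Ω`. -/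
noncomputable def powMeasure (Ω : Set (Eucl N)) (p : ℝ) (u : Eucl N → ℝ) : Measure (Eucl N) :=
  (volume.restrict Ω).withDensity fun x => ENNReal.ofReal (u x) ^ p

theorem integral_powMeasure {p : ℝ} (hp : 1 < p) {u : Eucl N → ℝ}
    (hu : AEMeasurable u (volume.restrict Ω)) (hu0 : ∀ᵐ x ∂(volume.restrict Ω), 0 ≤ u x)
    (f : Eucl N → ℝ) : ∫ x, f x ∂(powMeasure Ω p u) = ∫ x in Ω, u x ^ p * f x := by
  have hp0 : 0 < p := by linarith
  unfold powMeasure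
  rw [integral_withDensity_eq_integral_toReal_smul₀ (hu.ennreal_ofReal.pow_const p)
    (Eventually.of_forall fun x => ENNReal.rpow_lt_top_of_nonneg hp0.le ENNReal.ofReal_ne_top)]
  refine integral_congr_ae ?_
  filter_upwards [hu0] with x hx
  rw [← ENNReal.toReal_rpow, ENNReal.toReal_ofReal hx, smul_eq_mul]

theorem lintegral_weight_powMeasure (hγ : 0 < γ) {p : ℝ} {u : Eucl N → ℝ}
    (hu : AEMeasurable u (volume.restrict Ω)) :
    ∫⁻ x, weight Ω γ x ∂(powMeasure Ω p u)
      = ∫⁻ x in Ω, ENNReal.ofReal (u x) ^ p * weight Ω γ x := by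
  unfold powMeasure
  rw [lintegral_withDensity_eq_lintegral_mul₀ (hu.ennreal_ofReal.pow_const p)
    (measurable_weight hγ.le).aemeasurable]
  rfl

/-- The right-hand side of the weak-dual identity as an integral against `ξ`. -/
theorem integral_greenFun_add (hΩ : IsBoundedC2Domain Ω) (hN0 : 0 < N) (hγ : 0 < γ)
    (hG : IsGreenFunction Ω s γ L G)
    (h : IsWeightedKernel (volume.restrict Ω) Ω (greenKernel Ω s γ G) (weight Ω γ) c C)
    {μ : Measure (Eucl N)} (hμ : IsWeightedRadon Ω γ μ) {p : ℝ} (hp : 1 < p) (lam : ℝ)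
    {u : Eucl N → ℝ} (hu : AEMeasurable u (volume.restrict Ω))
    (hu0 : ∀ᵐ x ∂(volume.restrict Ω), 0 ≤ u x)
    (hX : ∫⁻ x in Ω, ENNReal.ofReal (u x) ^ p * weight Ω γ x ≠ ⊤)
    {ξ : Eucl N → ℝ} (hξ : ξ ∈ weightedLinfty Ω γ) :
    Integrable (fun y => ((potential (greenKernel Ω s γ G) (powMeasure Ω p u) y).toReal
      + lam * (potential (greenKernel Ω s γ G) μ y).toReal) * ξ y) (volume.restrict Ω) ∧
    (∫ x in Ω, u x ^ p * greenFun Ω G ξ x) + lam * ∫ x in Ω, greenFun Ω G ξ x ∂μ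
      = ∫ y in Ω, ((potential (greenKernel Ω s γ G) (powMeasure Ω p u) y).toReal
        + lam * (potential (greenKernel Ω s γ G) μ y).toReal) * ξ y := by
  have := hμ.sFinite hΩ hN0 hγ
  have hw : ∫⁻ x, weight Ω γ x ∂μ ≠ ⊤ := by
    rw [← hμ.weightedNorm_eq]; exact hμ.finite_norm.ne
  have : SFinite (powMeasure Ω p u) := by unfold powMeasure; infer_instance
  have hθ : ∀ᵐ x ∂(powMeasure Ω p u), x ∈ Ω :=
    (withDensity_absolutelyContinuous _ _).ae_le h.ae_mem
  obtain ⟨i1, e1⟩ := integral_greenFun hN0 hG h hθ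
    (by rwa [lintegral_weight_powMeasure hγ hu]) hξ
  obtain ⟨i2, e2⟩ := integral_greenFun hN0 hG h hμ.ae_mem hw hξ
  have e3 : ∀ y, ((potential (greenKernel Ω s γ G) (powMeasure Ω p u) y).toReal
        + lam * (potential (greenKernel Ω s γ G) μ y).toReal) * ξ y
      = (potential (greenKernel Ω s γ G) (powMeasure Ω p u) y).toReal * ξ y
        + lam * ((potential (greenKernel Ω s γ G) μ y).toReal * ξ y) := fun y => by ring
  simp only [e3]
  refine ⟨i1.add (i2.const_mul lam), ?_⟩
  rw [integral_add i1 (i2.const_mul lam), integral_const_mul, ← e1, ← e2,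
    integral_powMeasure hp hu hu0, Measure.restrict_eq_self_of_ae_mem hμ.ae_mem]

theorem indicator_mem_weightedLinfty {A : Set (Eucl N)} (hA : MeasurableSet A) :
    A.indicator (fun x => bdist Ω x ^ γ) ∈ weightedLinfty Ω γ := by
  refine ⟨A.indicator fun _ => 1, ?_, fun x _ => ?_⟩
  · exact memLp_top_of_bound (measurable_const.indicator hA).aestronglyMeasurable 1
      (Eventually.of_forall fun x => by
        by_cases hx : x ∈ A <;> simp [hx])
  · by_cases hx : x ∈ A <;> simp [hx]

/-- Weak-dual solutions are the nonnegative functions of finite weighted norm that solve the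
integral equation `u = 𝔾[u^p] + λ 𝔾[μ]` almost everywhere. -/
theorem isNonnegWeakDualSolution_iff (hΩ : IsBoundedC2Domain Ω) (hN0 : 0 < N) (hγ : 0 < γ)
    (hG : IsGreenFunction Ω s γ L G)
    (h : IsWeightedKernel (volume.restrict Ω) Ω (greenKernel Ω s γ G) (weight Ω γ) c C)
    {μ : Measure (Eucl N)} (hμ : IsWeightedRadon Ω γ μ) {p : ℝ} (hp : 1 < p) {lam : ℝ}
    (hlam : 0 ≤ lam) {u : Eucl N → ℝ} :
    IsNonnegWeakDualSolution Ω γ G p lam μ u ↔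
      AEMeasurable u (volume.restrict Ω) ∧ (∀ᵐ x ∂(volume.restrict Ω), 0 ≤ u x) ∧
      ∫⁻ x in Ω, ENNReal.ofReal (u x) ^ p * weight Ω γ x ≠ ⊤ ∧
      ∀ᵐ x ∂(volume.restrict Ω), ENNReal.ofReal (u x)
        = (∫⁻ y in Ω, greenKernel Ω s γ G x y * ENNReal.ofReal (u y) ^ p)
          + ENNReal.ofReal lam * potential (greenKernel Ω s γ G) μ x := by
  have hsf := hμ.sFinite hΩ hN0 hγ
  have hsf' : SFinite (powMeasure Ω p u) := by unfold powMeasure; infer_instance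
  have hp0 : 0 < p := by linarith
  have hw : ∫⁻ x, weight Ω γ x ∂μ ≠ ⊤ := by
    rw [← hμ.weightedNorm_eq]; exact hμ.finite_norm.ne
  have hθ : ∀ᵐ x ∂(powMeasure Ω p u), x ∈ Ω :=
    (withDensity_absolutelyContinuous _ _).ae_le h.ae_mem
  -- for finite potentials the equation can be written with real numbers
  have hconv : AEMeasurable u (volume.restrict Ω) → (∀ᵐ x ∂(volume.restrict Ω), 0 ≤ u x) →
      ∫⁻ x in Ω, ENNReal.ofReal (u x) ^ p * weight Ω γ x ≠ ⊤ →
      ∀ᵐ x ∂(volume.restrict Ω), (ENNReal.ofReal (u x)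
        = (∫⁻ y in Ω, greenKernel Ω s γ G x y * ENNReal.ofReal (u y) ^ p)
          + ENNReal.ofReal lam * potential (greenKernel Ω s γ G) μ x) ↔
        u x = (potential (greenKernel Ω s γ G) (powMeasure Ω p u) x).toReal
          + lam * (potential (greenKernel Ω s γ G) μ x).toReal := by
    intro hu hu0 hX
    filter_upwards [h.ae_potential_lt_top hθ (by rwa [lintegral_weight_powMeasure hγ hu]),
      h.ae_potential_lt_top hμ.ae_mem hw, hu0] with x h1 h2 h3
    rw [← h.potential_withDensity (hu.ennreal_ofReal.pow_const p) x]
    change ENNReal.ofReal (u x) = potential (greenKernel Ω s γ G) (powMeasure Ω p u) x + _ ↔ _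
    have ht : potential (greenKernel Ω s γ G) (powMeasure Ω p u) x
        + ENNReal.ofReal lam * potential (greenKernel Ω s γ G) μ x ≠ ⊤ :=
      ENNReal.add_ne_top.2 ⟨h1.ne, ENNReal.mul_ne_top ENNReal.ofReal_ne_top h2.ne⟩
    rw [← ENNReal.toReal_eq_toReal_iff' ENNReal.ofReal_ne_top ht, ENNReal.toReal_ofReal h3,
      ENNReal.toReal_add h1.ne (ENNReal.mul_ne_top ENNReal.ofReal_ne_top h2.ne),
      ENNReal.toReal_mul, ENNReal.toReal_ofReal hlam]
  constructor
  · rintro ⟨hu0, hLp, hweak⟩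
    have hu := aemeasurable_of_memLp hΩ hN0 hγ hLp
    have hX := (memLp_weightedVolume_iff hγ hp hu hu0).1 hLp
    refine ⟨hu, hu0, hX, ?_⟩
    -- `u δ^γ` is integrable because `δ^γ dx` is a finite measure
    have hfin : IsFiniteMeasure (weightedVolume Ω γ) := by
      refine isFiniteMeasure_withDensity ?_
      have : (∫⁻ x in Ω, weight Ω γ x) ≤ C * volume Ω := by
        rw [← setLIntegral_const]
        refine lintegral_mono_ae ?_
        filter_upwards [h.ae_mem] with x hx using h.weight_le x hx
      exact ne_top_of_le_ne_top
        (ENNReal.mul_ne_top h.upper_ne_top hΩ.isBounded.measure_lt_top.ne) this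
    have hint : Integrable (fun x => u x * bdist Ω x ^ γ) (volume.restrict Ω) := by
      have h1 : Integrable u (weightedVolume Ω γ) := hLp.integrable (by simpa using hp.le)
      have h2 := (integrable_withDensity_iff_integrable_smul₀' (measurable_weight
        hγ.le).aemeasurable (Eventually.of_forall fun x => ENNReal.ofReal_lt_top)).1 h1
      refine h2.congr (Eventually.of_forall fun x => ?_)
      simp only [weight, smul_eq_mul]
      rw [ENNReal.toReal_ofReal (Real.rpow_nonneg (bdist_nonneg _) _), mul_comm]
    set q : Eucl N → ℝ := fun y =>
      (potential (greenKernel Ω s γ G) (powMeasure Ω p u) y).toReal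
        + lam * (potential (greenKernel Ω s γ G) μ y).toReal with hq
    have huniv := integral_greenFun_add hΩ hN0 hγ hG h hμ hp lam hu hu0 hX
      (indicator_mem_weightedLinfty (Ω := Ω) (γ := γ) MeasurableSet.univ)
    have hqi : Integrable (fun x => q x * bdist Ω x ^ γ) (volume.restrict Ω) := by
      simpa using huniv.1
    have hzero := (hint.sub hqi).ae_eq_zero_of_forall_setIntegral_eq_zero fun A hA _ => by
      have e := hweak _ (indicator_mem_weightedLinfty (Ω := Ω) (γ := γ) hA)
      rw [(integral_greenFun_add hΩ hN0 hγ hG h hμ hp lam hu hu0 hX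
        (indicator_mem_weightedLinfty (Ω := Ω) (γ := γ) hA)).2] at e
      have conv : ∀ f : Eucl N → ℝ, (∫ x in Ω, f x * A.indicator (fun x => bdist Ω x ^ γ) x)
          = ∫ x in A, f x * bdist Ω x ^ γ ∂(volume.restrict Ω) := fun f => by
        rw [← integral_indicator hA]
        refine integral_congr_ae (Eventually.of_forall fun x => ?_)
        by_cases hx : x ∈ A <;> simp [hx]
      rw [conv, conv] at e
      simp only [Pi.sub_apply]
      rw [integral_sub hint.integrableOn hqi.integrableOn, e, sub_self]
    filter_upwards [hzero, hconv hu hu0 hX, h.ae_mem] with x hx hc hxS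
    rw [hc]
    have hδ : bdist Ω x ^ γ ≠ 0 := (Real.rpow_pos_of_pos (hΩ.bdist_pos hN0 hxS) _).ne'
    have : (u x - q x) * bdist Ω x ^ γ = 0 := by
      rw [sub_mul]; exact hx
    exact sub_eq_zero.1 ((mul_eq_zero.1 this).resolve_right hδ)
  · rintro ⟨hu, hu0, hX, heq⟩
    refine ⟨hu0, (memLp_weightedVolume_iff hγ hp hu hu0).2 hX, fun ξ hξ => ?_⟩
    rw [(integral_greenFun_add hΩ hN0 hγ hG h hμ hp lam hu hu0 hX hξ).2]
    refine integral_congr_ae ?_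
    filter_upwards [heq, hconv hu hu0 hX] with x hx hc
    rw [hc.1 hx]

end Duality

/-! ### Point masses near the boundary and the two ranges of `p` -/

section Blowup
variable {N : ℕ} {Ω : Set (Eucl N)} {s γ : ℝ}
variable {L : (Eucl N → ℝ) →ₗ.[ℝ] (Ω → ℝ)} {G : Eucl N → Eucl N → ℝ} {c C : ℝ≥0∞}

/-- The largest ball around a point that avoids the boundary lies in the domain, so that the boundary
point nearest to its centre admits an interior ball. -/
theorem ball_subset_domain (hΩ : IsOpen Ω) {x₀ : Eucl N} (hx₀ : x₀ ∈ Ω) :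
    Metric.ball x₀ (bdist Ω x₀) ⊆ Ω := by
  rcases (bdist_nonneg (Ω := Ω) x₀).eq_or_lt with h0 | hR
  · simp [← h0]
  refine (convex_ball x₀ _).isPreconnected.subset_left_of_subset_union hΩ
    (isClosed_closure (s := Ω)).isOpen_compl
    (Set.disjoint_compl_right_iff_subset.2 subset_closure) (fun y hy => ?_)
    ⟨x₀, Metric.mem_ball_self hR, hx₀⟩
  by_contra hyn
  rw [Set.mem_union, not_or, Set.notMem_compl_iff] at hyn
  have hyf : y ∈ frontier Ω := by
    rw [hΩ.frontier_eq]; exact ⟨hyn.2, hyn.1⟩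
  have h1 : bdist Ω x₀ ≤ dist x₀ y := Metric.infDist_le_dist_of_mem hyf
  rw [Metric.mem_ball, dist_comm] at hy
  exact absurd hy (not_lt.2 h1)

/-- Let `z₀` be a boundary point nearest to `x₀`. Near the point at fraction `t` of the segment from
`z₀` to `x₀`, the distances to the boundary and to `z₀` are comparable to `t δ(x₀)`. -/
theorem bdist_bounds_near_segment {x₀ z₀ y : Eucl N} (hz₀ : z₀ ∈ frontier Ω)
    (hd : ‖x₀ - z₀‖ = bdist Ω x₀) {t : ℝ} (ht0 : 0 < t) (ht1 : t ≤ 1)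
    (hy : ‖y - (z₀ + t • (x₀ - z₀))‖ < t * bdist Ω x₀ / 4) :
    3 / 4 * (t * bdist Ω x₀) < bdist Ω y ∧ bdist Ω y ≤ ‖y - z₀‖ ∧
      3 / 4 * (t * bdist Ω x₀) < ‖y - z₀‖ ∧ ‖y - z₀‖ < 5 / 4 * (t * bdist Ω x₀) ∧
      ‖y - x₀‖ < bdist Ω x₀ := by
  set R := bdist Ω x₀ with hR
  have h1 : ‖y - x₀‖ ≤ ‖y - (z₀ + t • (x₀ - z₀))‖ + (1 - t) * R := by
    have e : y - x₀ = (y - (z₀ + t • (x₀ - z₀))) - (1 - t) • (x₀ - z₀) := by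
      module
    rw [e]
    refine (norm_sub_le _ _).trans (le_of_eq ?_)
    rw [norm_smul, Real.norm_of_nonneg (by linarith), hd]
  have h2 : ‖y - z₀‖ ≤ ‖y - (z₀ + t • (x₀ - z₀))‖ + t * R := by
    have e : y - z₀ = (y - (z₀ + t • (x₀ - z₀))) + t • (x₀ - z₀) := by module
    rw [e]
    refine (norm_add_le _ _).trans (le_of_eq ?_)
    rw [norm_smul, Real.norm_of_nonneg ht0.le, hd]
  have h3 : R ≤ bdist Ω y + ‖x₀ - y‖ := bdist_le_add x₀ y
  have h4 : bdist Ω y ≤ ‖y - z₀‖ := by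
    rw [← dist_eq_norm]; exact Metric.infDist_le_dist_of_mem hz₀
  rw [norm_sub_rev] at h3
  have h5 : 0 ≤ ‖y - (z₀ + t • (x₀ - z₀))‖ := norm_nonneg _
  refine ⟨by linarith, h4, by linarith, by linarith, by linarith⟩

/-- In the supercritical range the potentials of normalized point masses are not bounded in
`L^p(Ω, δ^γ)`. The point masses approach a boundary point `z₀` admitting an interior ball, and each
dyadic scale between `z₀` and the point mass contributes at least a fixed amount. -/
theorem exists_lt_lintegral_greenKernel_rpow (hΩ : IsBoundedC2Domain Ω) (hs : 0 < s) (hγ : 0 < γ)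
    (hN : 2 * s < N) (hG : IsGreenFunction Ω s γ L G) {p : ℝ} (hp : 1 < p)
    (hpc : criticalExponent N s γ ≤ p) {M : ℝ≥0∞} (hM : M ≠ ⊤) :
    ∃ z ∈ Ω, M < ∫⁻ y in Ω, (greenKernel Ω s γ G y z / weight Ω γ z) ^ p * weight Ω γ y := by
  have hN0 : 0 < N := by
    have : (0 : ℝ) < N := by linarith
    exact_mod_cast this
  have hp0 : 0 < p := by linarith
  have : Nonempty (Fin N) := ⟨⟨0, hN0⟩⟩
  obtain ⟨a, A, ha, hat, hAt, hk⟩ := greenKernel_bounds hΩ hN0 hγ hG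
  obtain ⟨x₀, hx₀⟩ := hΩ.isConnected.nonempty
  obtain ⟨z₀, hz₀, hd⟩ := isClosed_frontier.exists_infDist_eq_dist
    (hΩ.frontier_nonempty hN0) x₀
  have hd' : ‖x₀ - z₀‖ = bdist Ω x₀ := by rw [← dist_eq_norm]; exact hd.symm
  set R := bdist Ω x₀ with hR
  have hR0 : 0 < R := hΩ.bdist_pos hN0 hx₀
  set t : ℕ → ℝ := fun j => (1 / 2) ^ j with ht
  have ht0 : ∀ j, 0 < t j := fun j => by positivity
  have ht1 : ∀ j, t j ≤ 1 := fun j => pow_le_one₀ (by norm_num) (by norm_num)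
  have htanti : ∀ i j, i ≤ j → t j ≤ t i := fun i j hij =>
    pow_le_pow_of_le_one (by norm_num) (by norm_num) hij
  set Z : ℕ → Eucl N := fun j => z₀ + t j • (x₀ - z₀) with hZ
  set B : ℕ → Set (Eucl N) := fun j => Metric.ball (Z j) (t j * R / 4) with hB
  have hBb : ∀ j, ∀ y ∈ B j, 3 / 4 * (t j * R) < bdist Ω y ∧ bdist Ω y ≤ ‖y - z₀‖ ∧
      3 / 4 * (t j * R) < ‖y - z₀‖ ∧ ‖y - z₀‖ < 5 / 4 * (t j * R) ∧ ‖y - x₀‖ < R := by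
    intro j y hy
    rw [hB, Metric.mem_ball, dist_eq_norm] at hy
    exact bdist_bounds_near_segment hz₀ hd' (ht0 j) (ht1 j) hy
  have hBΩ : ∀ j, B j ⊆ Ω := fun j y hy => ball_subset_domain hΩ.isOpen hx₀ (by
    rw [Metric.mem_ball, dist_eq_norm]; exact (hBb j y hy).2.2.2.2)
  have hZB : ∀ j, Z j ∈ B j := fun j => Metric.mem_ball_self (by have := ht0 j; positivity)
  have hdisj : ∀ i j, i < j → Disjoint (B i) (B j) := by
    intro i j hij
    rw [Set.disjoint_left]
    intro y hyi hyj
    have h1 := (hBb i y hyi).2.2.1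
    have h2 := (hBb j y hyj).2.2.2.1
    have h3 : t j ≤ 1 / 2 * t i := by
      have := htanti (i + 1) j hij
      simpa [ht, pow_succ, mul_comm] using this
    have h4 := mul_le_mul_of_nonneg_right h3 hR0.le
    have h5 := mul_pos (ht0 i) hR0
    linarith
  -- the contribution of one dyadic scale is at least `κ`
  set q : ℝ := (N : ℝ) - 2 * s + 2 * γ with hq
  set E : ℝ := γ * p - q * p + γ + N with hE
  have hE0 : E ≤ 0 := by
    rw [criticalExponent, div_le_iff₀ (by linarith)] at hpc
    rw [hE, hq]; linarith
  set V := volume (Metric.ball (0 : Eucl N) 1) with hV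
  set k₀ : ℝ := ((1 / 2) ^ γ * (4 ^ q)⁻¹) ^ p * (1 / 2) ^ γ * (1 / 4) ^ N with hk₀
  have hk₀pos : 0 < k₀ := by positivity
  set κ : ℝ≥0∞ := a ^ p * ENNReal.ofReal (k₀ * R ^ E) * V with hκ
  have hV0 : V ≠ 0 := (Metric.isOpen_ball.measure_pos _ ⟨0, by simp⟩).ne'
  have hκ0 : κ ≠ 0 := by
    refine mul_ne_zero (mul_ne_zero ?_ ?_) hV0
    · simp [ENNReal.rpow_eq_zero_iff, ha, hat]
    · have : 0 < k₀ * R ^ E := by positivity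
      simpa using this
  obtain ⟨n, hn⟩ := ENNReal.exists_nat_mul_gt hκ0 hM
  refine ⟨Z n, hBΩ n (hZB n), hn.trans_le ?_⟩
  set f : Eucl N → ℝ≥0∞ := fun y =>
    (greenKernel Ω s γ G y (Z n) / weight Ω γ (Z n)) ^ p * weight Ω γ y with hf
  have hscale : ∀ j ≤ n, κ ≤ ∫⁻ y in B j, f y := by
    intro j hj
    set τ := t j * R with hτ
    have hτ0 : 0 < τ := mul_pos (ht0 j) hR0
    have hτR : τ ≤ R := mul_le_of_le_one_left hR0.le (ht1 j)
    have hvol : volume (B j) = ENNReal.ofReal ((τ / 4) ^ N) * V := by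
      rw [hB, Measure.addHaar_ball _ _ (by positivity)]
      simp [hτ, hV]
    have hpt : ∀ y ∈ B j, a ^ p * ENNReal.ofReal
        (((τ / 2) ^ γ * ((4 * τ) ^ q)⁻¹) ^ p * (τ / 2) ^ γ) ≤ f y := by
      intro y hy
      obtain ⟨b1, b2, b3, b4, -⟩ := hBb j y hy
      obtain ⟨c1, c2, c3, c4, -⟩ := hBb n (Z n) (hZB n)
      have hnj : t n * R ≤ τ := mul_le_mul_of_nonneg_right (htanti j n hj) hR0.le
      have hdist : ‖y - Z n‖ ≤ 4 * τ := by
        have := norm_sub_le_norm_sub_add_norm_sub y z₀ (Z n)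
        rw [norm_sub_rev z₀] at this
        linarith
      have hscl : pairScale Ω y (Z n) ≤ 4 * τ :=
        max_le hdist (max_le (by linarith) (by linarith))
      have hqd : quasiDist Ω s γ y (Z n) ≤ (4 * τ) ^ q := by
        rw [hq, Real.rpow_add (by positivity)]
        exact mul_le_mul (Real.rpow_le_rpow (norm_nonneg _) hdist (by linarith))
          (Real.rpow_le_rpow (pairScale_nonneg _ _) hscl (by linarith))
          (Real.rpow_nonneg (pairScale_nonneg _ _) _) (by positivity)
      have hw : ENNReal.ofReal ((τ / 2) ^ γ) ≤ weight Ω γ y :=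
        ENNReal.ofReal_le_ofReal (Real.rpow_le_rpow (by positivity) (by linarith) hγ.le)
      have hH : ENNReal.ofReal (((4 * τ) ^ q)⁻¹) ≤ reducedKernel Ω s γ y (Z n) := by
        rw [ENNReal.ofReal_inv_of_pos (by positivity)]
        exact ENNReal.inv_le_inv.2 (ENNReal.ofReal_le_ofReal hqd)
      have hquot : a * (weight Ω γ y * reducedKernel Ω s γ y (Z n))
          ≤ greenKernel Ω s γ G y (Z n) / weight Ω γ (Z n) := by
        have hZΩ := hBΩ n (hZB n)
        rw [ENNReal.le_div_iff_mul_le (Or.inl (weight_ne_zero hΩ hN0 hZΩ))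
          (Or.inl (weight_ne_top _))]
        refine le_trans (le_of_eq ?_) (hk y (hBΩ j hy) (Z n) hZΩ).1
        ring
      calc a ^ p * ENNReal.ofReal (((τ / 2) ^ γ * ((4 * τ) ^ q)⁻¹) ^ p * (τ / 2) ^ γ)
          = (a * (ENNReal.ofReal ((τ / 2) ^ γ) * ENNReal.ofReal (((4 * τ) ^ q)⁻¹))) ^ p
            * ENNReal.ofReal ((τ / 2) ^ γ) := by
            rw [ENNReal.mul_rpow_of_nonneg _ _ hp0.le, ← ENNReal.ofReal_mul (by positivity),
              ENNReal.ofReal_rpow_of_nonneg (by positivity) hp0.le, mul_assoc,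
              ← ENNReal.ofReal_mul (by positivity)]
        _ ≤ (a * (weight Ω γ y * reducedKernel Ω s γ y (Z n))) ^ p * weight Ω γ y := by gcongr
        _ ≤ f y := mul_le_mul' (ENNReal.rpow_le_rpow hquot hp0.le) le_rfl
    calc κ ≤ a ^ p * ENNReal.ofReal (((τ / 2) ^ γ * ((4 * τ) ^ q)⁻¹) ^ p * (τ / 2) ^ γ)
          * (ENNReal.ofReal ((τ / 4) ^ N) * V) := by
          rw [hκ, ← mul_assoc (a ^ p * _), mul_assoc (a ^ p) _ (ENNReal.ofReal ((τ / 4) ^ N)),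
            ← ENNReal.ofReal_mul (by positivity)]
          refine mul_le_mul' (mul_le_mul' le_rfl (ENNReal.ofReal_le_ofReal ?_)) le_rfl
          have e : ((τ / 2) ^ γ * ((4 * τ) ^ q)⁻¹) ^ p * (τ / 2) ^ γ * (τ / 4) ^ N
              = k₀ * τ ^ E := by
            have e1 : (τ / 2) ^ γ = (1 / 2) ^ γ * τ ^ γ := by
              rw [← Real.mul_rpow (by norm_num) hτ0.le]; congr 1; ring
            have e2 : ((4 * τ) ^ q)⁻¹ = (4 ^ q)⁻¹ * τ ^ (-q) := by
              rw [Real.mul_rpow (by norm_num) hτ0.le, mul_inv, Real.rpow_neg hτ0.le]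
            have e3 : (τ / 4) ^ N = (1 / 4) ^ N * τ ^ (N : ℝ) := by
              rw [Real.rpow_natCast, ← mul_pow]; congr 1; ring
            have e4 : (1 / 2) ^ γ * τ ^ γ * ((4 ^ q)⁻¹ * τ ^ (-q))
                = ((1 / 2) ^ γ * (4 ^ q)⁻¹) * τ ^ (γ - q) := by
              rw [sub_eq_add_neg, Real.rpow_add hτ0]; ring
            have e5 : τ ^ E = τ ^ ((γ - q) * p) * τ ^ γ * τ ^ (N : ℝ) := by
              rw [← Real.rpow_add hτ0, ← Real.rpow_add hτ0, hE]; congr 1; ring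
            rw [e1, e2, e3, e4, Real.mul_rpow (by positivity) (by positivity),
              ← Real.rpow_mul hτ0.le, e5, hk₀]
            ring
          rw [e]
          exact mul_le_mul_of_nonneg_left (Real.rpow_le_rpow_of_nonpos hτ0 hτR hE0) hk₀pos.le
      _ = ∫⁻ _ in B j, a ^ p * ENNReal.ofReal
            (((τ / 2) ^ γ * ((4 * τ) ^ q)⁻¹) ^ p * (τ / 2) ^ γ) := by
          rw [setLIntegral_const, hvol]
      _ ≤ ∫⁻ y in B j, f y := setLIntegral_mono' Metric.isOpen_ball.measurableSet hpt
  calc (n : ℝ≥0∞) * κ = ∑ _j ∈ Finset.range n, κ := by simp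
    _ ≤ ∑ j ∈ Finset.range n, ∫⁻ y in B j, f y :=
        Finset.sum_le_sum fun j hj => hscale j (Finset.mem_range.1 hj).le
    _ = ∫⁻ y in ⋃ j ∈ Finset.range n, B j, f y := by
        refine (lintegral_biUnion_finset ?_ (fun j _ => Metric.isOpen_ball.measurableSet) f).symm
        intro i _ j _ hij
        rcases lt_or_gt_of_ne hij with h | h
        · exact hdisj i j h
        · exact (hdisj j i h).symm
    _ ≤ ∫⁻ y in Ω, f y := lintegral_mono_set (Set.iUnion₂_subset fun j _ => hBΩ j)

/-- For a normalized point mass close enough to a suitable boundary point, the a priori bound is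
violated. -/
theorem exists_no_solution (hΩ : IsBoundedC2Domain Ω) (hs : 0 < s) (hγ : 0 < γ)
    (hN : 2 * s < N) (hG : IsGreenFunction Ω s γ L G) {p : ℝ} (hp : 1 < p)
    (hpc : criticalExponent N s γ ≤ p) {lam : ℝ} (hlam : 0 < lam) :
    ∃ μ : Measure (Eucl N), IsWeightedRadon Ω γ μ ∧ weightedNorm Ω γ μ = 1 ∧
      ¬ ∃ u : Eucl N → ℝ, IsNonnegWeakDualSolution Ω γ G p lam μ u := by
  have hN0 : 0 < N := by
    have : (0 : ℝ) < N := by linarith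
    exact_mod_cast this
  have hp0 : 0 < p := by linarith
  obtain ⟨c, C, h⟩ := exists_isWeightedKernel hΩ hs hγ hN hG
  set β := aprioriBound (volume.restrict Ω) (weight Ω γ) c p with hβ
  have hβt : β ≠ ⊤ := h.aprioriBound_ne_top hp
  have hl0 : ENNReal.ofReal lam ^ p ≠ 0 := by
    simp [ENNReal.rpow_eq_zero_iff, hlam]
  have hlt : ENNReal.ofReal lam ^ p ≠ ⊤ :=
    ENNReal.rpow_ne_top_of_nonneg hp0.le ENNReal.ofReal_ne_top
  obtain ⟨z, hz, hzM⟩ := exists_lt_lintegral_greenKernel_rpow hΩ hs hγ hN hG hp hpc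
    (ENNReal.div_ne_top hβt hl0)
  have hw0 := weight_ne_zero (γ := γ) hΩ hN0 hz
  have hwt := weight_ne_top (Ω := Ω) (γ := γ) z
  set μ : Measure (Eucl N) := (weight Ω γ z)⁻¹ • Measure.dirac z with hμdef
  have hnorm : ∫⁻ x, weight Ω γ x ∂μ = 1 := by
    rw [hμdef, lintegral_smul_measure, lintegral_dirac, smul_eq_mul,
      ENNReal.inv_mul_cancel hw0 hwt]
  have hcar : μ Ωᶜ = 0 := by
    rw [hμdef, Measure.smul_apply, Measure.dirac_apply' _ hΩ.isOpen.measurableSet.compl]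
    simp [hz]
  have hnorm' : weightedNorm Ω γ μ = 1 := by
    unfold weightedNorm
    rw [Measure.restrict_eq_self_of_ae_mem (mem_ae_iff.2 hcar)]; exact hnorm
  have hμ : IsWeightedRadon Ω γ μ := by
    refine ⟨hcar, fun K _ _ => ?_, by simp [hnorm']⟩
    rw [hμdef, Measure.smul_apply, smul_eq_mul]
    exact ENNReal.mul_lt_top (ENNReal.inv_lt_top.2 hw0.bot_lt) (measure_lt_top _ _)
  have hpot : ∀ x, potential (greenKernel Ω s γ G) μ x
      = greenKernel Ω s γ G x z / weight Ω γ z := by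
    intro x
    rw [potential, hμdef, lintegral_smul_measure, lintegral_dirac, smul_eq_mul, mul_comm]
    rfl
  refine ⟨μ, hμ, hnorm', ?_⟩
  rintro ⟨u, hu⟩
  obtain ⟨hum, -, hX, heq⟩ := (isNonnegWeakDualSolution_iff hΩ hN0 hγ hG h hμ hp hlam.le).1 hu
  have hle := h.add_le_aprioriBound hp hμ.ae_mem hnorm (by simpa using hlam)
    ENNReal.ofReal_ne_top hum.ennreal_ofReal (heq.mono fun x hx => hx.ge) hX
  have hlow : ENNReal.ofReal lam ^ p
      * ∫⁻ y in Ω, (greenKernel Ω s γ G y z / weight Ω γ z) ^ p * weight Ω γ y ≤ β := by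
    have hm : Measurable fun y => (greenKernel Ω s γ G y z / weight Ω γ z) ^ p * weight Ω γ y :=
      (((h.measurable_section' z).div_const _).pow_const p).mul h.measurable_weight
    rw [← lintegral_const_mul _ hm]
    refine le_trans (lintegral_mono_ae ?_) (le_self_add.trans hle)
    filter_upwards [heq] with x hx
    rw [← mul_assoc, ← ENNReal.mul_rpow_of_nonneg _ _ hp0.le, ← hpot, hx]
    gcongr
    exact le_add_self
  have h1 := ENNReal.mul_lt_mul_right hl0 hlt hzM
  rw [ENNReal.mul_div_cancel hl0 hlt] at h1
  exact absurd h1 (not_lt.2 hlow)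

theorem exists_threshold_of_subcritical (hΩ : IsBoundedC2Domain Ω) (hs : 0 < s) (hγ : 0 < γ)
    (hN : 2 * s < N) (hG : IsGreenFunction Ω s γ L G) {p : ℝ} (hp : 1 < p)
    (hpc : p < criticalExponent N s γ) {μ : Measure (Eucl N)} (hμ : IsWeightedRadon Ω γ μ)
    (hμ1 : weightedNorm Ω γ μ = 1) :
    ∃ lamStar : ℝ, 0 < lamStar ∧
      (∃ T : ℝ → ℝ, StrictMonoOn T (Set.Ioc 0 lamStar) ∧ Tendsto T (𝓝[>] 0) (𝓝 0) ∧
        ∀ lam ∈ Set.Ioc 0 lamStar, ∃ u : Eucl N → ℝ,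
          IsMinimalPositiveSolution Ω γ G p lam μ u ∧
          ∀ᵐ x ∂(volume.restrict Ω),
            lam * greenMeas Ω G μ x ≤ u x ∧ u x ≤ T lam * greenMeas Ω G μ x) ∧
      (∀ lam : ℝ, lamStar < lam →
        ¬ ∃ u : Eucl N → ℝ, IsNonnegWeakDualSolution Ω γ G p lam μ u) := by
  have hN0 : 0 < N := by
    have : (0 : ℝ) < N := by linarith
    exact_mod_cast this
  have hp0 : 0 < p := by linarith
  obtain ⟨c, C, h⟩ := exists_isWeightedKernel hΩ hs hγ hN hG
  obtain ⟨K, hK⟩ := exists_isSubcritical hΩ hs hγ hN hG hp hpc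
  have := hμ.sFinite hΩ hN0 hγ
  have hnorm : ∫⁻ x, weight Ω γ x ∂μ = 1 := by rw [← hμ.weightedNorm_eq, hμ1]
  obtain ⟨lamStar, A, hpos, hA, hex, hnon⟩ := h.exists_threshold hp hK hμ.ae_mem hnorm
  refine ⟨lamStar, hpos, ⟨fun l => A * l, ?_, ?_, ?_⟩, ?_⟩
  · exact fun a _ b _ hab => mul_lt_mul_of_pos_left hab hA
  · have : Tendsto (fun l : ℝ => A * l) (𝓝 0) (𝓝 (A * 0)) := tendsto_id.const_mul A
    rw [mul_zero] at this
    exact this.mono_left nhdsWithin_le_nhds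
  · intro l hl
    obtain ⟨hfin, hub⟩ := hex l hl
    have hPm : Measurable (potential (greenKernel Ω s γ G) μ) := h.measurable_potential μ
    set U := leastSolution (greenKernel Ω s γ G) (volume.restrict Ω) p
      (fun x => ENNReal.ofReal l * potential (greenKernel Ω s γ G) μ x) with hU
    have hUm : Measurable U := h.measurable_leastSolution (hPm.const_mul _)
    have hUt := h.ae_lt_top_of_lintegral_ne_top hUm.aemeasurable hp0 hfin
    have hUr : ∀ᵐ x ∂(volume.restrict Ω), ENNReal.ofReal (U x).toReal = U x := by
      filter_upwards [hUt] with x hx using ENNReal.ofReal_toReal hx.ne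
    have hUeq := h.leastSolution_eq (p := p) (hPm.const_mul (ENNReal.ofReal l)) hp0
    have hUlow : ∀ x, ENNReal.ofReal l * potential (greenKernel Ω s γ G) μ x ≤ U x := fun x => by
      rw [hU, hUeq]; exact le_add_self
    refine ⟨fun x => (U x).toReal, ⟨?_, ?_, ?_⟩, ?_⟩
    · refine (isNonnegWeakDualSolution_iff hΩ hN0 hγ hG h hμ hp hl.1.le).2
        ⟨hUm.ennreal_toReal.aemeasurable, Eventually.of_forall fun x => ENNReal.toReal_nonneg,
          ?_, ?_⟩
      · refine ne_of_eq_of_ne (lintegral_congr_ae ?_) hfin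
        filter_upwards [hUr] with x hx
        rw [hx]
      · filter_upwards [hUr] with x hx
        rw [hx]
        refine (hUeq x).trans ?_
        congr 1
        refine lintegral_congr_ae ?_
        filter_upwards [hUr] with y hy
        rw [hy]
    · filter_upwards [hUt, h.ae_mem] with x hx hxS
      refine ENNReal.toReal_pos ?_ hx.ne
      have h1 := h.le_potential hμ.ae_mem hxS
      rw [hnorm, mul_one] at h1
      have h2 : ENNReal.ofReal l * (c * weight Ω γ x) ≠ 0 :=
        mul_ne_zero (by simpa using hl.1) (mul_ne_zero h.lower_ne_zero (h.weight_ne_zero x hxS))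
      intro h0
      refine h2 (le_antisymm ?_ zero_le)
      calc _ ≤ ENNReal.ofReal l * potential (greenKernel Ω s γ G) μ x := by gcongr
        _ ≤ U x := hUlow x
        _ = 0 := h0
    · intro v hv
      obtain ⟨-, hv0, -, hveq⟩ :=
        (isNonnegWeakDualSolution_iff hΩ hN0 hγ hG h hμ hp hl.1.le).1 hv
      filter_upwards [leastSolution_le hp0.le (hveq.mono fun x hx => hx.ge), hv0] with x hx hx0
      exact ENNReal.toReal_le_of_le_ofReal hx0 hx
    · filter_upwards [hUt, hub, ae_greenMeas_eq hΩ hN hN0 hG h hμ] with x h1 h2 h3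
      rw [h3.2]
      constructor
      · have := ENNReal.toReal_mono h1.ne (hUlow x)
        rwa [ENNReal.toReal_mul, ENNReal.toReal_ofReal hl.1.le] at this
      · have := ENNReal.toReal_mono (ENNReal.mul_ne_top ENNReal.ofReal_ne_top h3.1.ne) h2
        rwa [ENNReal.toReal_mul, ENNReal.toReal_ofReal (mul_nonneg hA.le hl.1.le)] at this
  · rintro l hl ⟨u, hu⟩
    obtain ⟨-, -, hX, heq⟩ :=
      (isNonnegWeakDualSolution_iff hΩ hN0 hγ hG h hμ hp (hpos.trans hl).le).1 hu
    exact hX (hnon l hl _ (heq.mono fun x hx => hx.ge))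

end Blowup

end NonlocalGreen

theorem theorem3p3 {N : ℕ} (Ω : Set (NonlocalGreen.Eucl N)) (hΩ : NonlocalGreen.IsBoundedC2Domain Ω)
    (s γ : ℝ) (hs₀ : 0 < s) (hs₁ : s ≤ 1) (hγ₀ : 0 < γ) (hγ₁ : γ ≤ 1)
    (hN : 2 * s < (N : ℝ)) (hγs : s - 1 / 2 ≤ γ)
    (L : (NonlocalGreen.Eucl N → ℝ) →ₗ.[ℝ] (Ω → ℝ))
    (G : NonlocalGreen.Eucl N → NonlocalGreen.Eucl N → ℝ)
    (hG : NonlocalGreen.IsGreenFunction Ω s γ L G)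
    (p : ℝ) (hp : 1 < p) :
    (p < NonlocalGreen.criticalExponent N s γ →
      ∀ μ : Measure (NonlocalGreen.Eucl N), NonlocalGreen.IsWeightedRadon Ω γ μ →
        NonlocalGreen.weightedNorm Ω γ μ = 1 →
        ∃ lamStar : ℝ, 0 < lamStar ∧
          (∃ T : ℝ → ℝ, StrictMonoOn T (Set.Ioc 0 lamStar) ∧ Tendsto T (𝓝[>] 0) (𝓝 0) ∧
            ∀ lam ∈ Set.Ioc 0 lamStar, ∃ u : NonlocalGreen.Eucl N → ℝ,
              NonlocalGreen.IsMinimalPositiveSolution Ω γ G p lam μ u ∧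
              ∀ᵐ x ∂(volume.restrict Ω),
                lam * NonlocalGreen.greenMeas Ω G μ x ≤ u x ∧
                  u x ≤ T lam * NonlocalGreen.greenMeas Ω G μ x) ∧
          (∀ lam : ℝ, lamStar < lam →
            ¬ ∃ u : NonlocalGreen.Eucl N → ℝ,
              NonlocalGreen.IsNonnegWeakDualSolution Ω γ G p lam μ u)) ∧
    (NonlocalGreen.criticalExponent N s γ ≤ p →
      ∀ lam : ℝ, 0 < lam →
        ∃ μ : Measure (NonlocalGreen.Eucl N), NonlocalGreen.IsWeightedRadon Ω γ μ ∧
          NonlocalGreen.weightedNorm Ω γ μ = 1 ∧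
          ¬ ∃ u : NonlocalGreen.Eucl N → ℝ,
            NonlocalGreen.IsNonnegWeakDualSolution Ω γ G p lam μ u) := by
  open NonlocalGreen in
  exact ⟨fun hpc μ hμ hμ1 => exists_threshold_of_subcritical hΩ hs₀ hγ₀ hN hG hp hpc hμ hμ1,
    fun hpc lam hlam => exists_no_solution hΩ hs₀ hγ₀ hN hG hp hpc hlam⟩
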